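/- **Setting.** Write $\mathbb R_+=(0,\infty)$, and for $x\in\mathbb R^2$, $u\in\mathbb R_+^2$ let $B(x,u)=[x_1-\frac{u_1}2,x_1+\frac{u_1}2]\times[x_2-\frac{u_2}2,x_2+\frac{u_2}2]$. Let $\gamma_1\in(1,2)$ and $\gamma_2>2$. Let $f_1,f_2:\mathbb R_+\to[0,\infty)$ be measurable with $f_i(u)\sim u^{-\gamma_i-1}$ as $u\to\infty$ for $i=1,2$, such that $F(\mathrm du)=f_1(u_1)f_2(u_2)\,\mathrm du_1\mathrm du_2$ is a probability measure on $\mathbb R_+^2$, and assume that there is $c_{f_1}>0$ with $f_1(u)\le c_{f_1}u^{-\gamma_1-1}$ for all $u>0$. For $\rho>0$ let $F_\rho$ be the image of $F$ under $u\mapsto\rho u$, let $\lambda_\rho>0$, and let $N_\rho$ be a Poisson random measure on $\mathbb R^2\times\mathbb R_+^2$ with intensity measure $\lambda_\rho\,\mathrm dx\,F_\rho(\mathrm du)$. For a finite signed Borel measure $\mu$ on $\mathbb R^2$ put $$J_\rho(\mu)=\int\mu(B(x,u))\,N_\rho(\mathrm dx,\mathrm du),\qquad \widetilde J_\rho(\mu)=J_\rho(\mu)-\mathbb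 E J_\rho(\mu).$$ Let $\mathcal M_L$ be the linear space of those finite signed measures $\mu$ on $\mathbb R^2$ which have a measurable density $f_\mu$ such that - there are $C_\mu,c_\mu>0$ with $|f_\mu(x)|\le C_\mu e^{-c_\mu(|x_1|+|x_2|)}$ for all $x\in\mathbb R^2$; - for all $x\in\mathbb R^2$ and $u_1>0$, as $\varepsilon\downarrow0$, $$\frac1\varepsilon\int_{B(x,(u_1,\varepsilon))}f_\mu(y)\,\mathrm dy\;\longrightarrow\;\int_{[x_1-\frac{u_1}2,x_1+\frac{u_1}2]}f_\mu(y_1,x_2)\,\mathrm dy_1 .$$ **Theorem (Gaussian-lines scaling regime).** Assume that, as $\rho\downarrow0$, $\lambda_\rho\to\infty$ and $\lambda_\rho\rho^{\gamma_1+\eta}\to1$ for some $\eta\in(0,\gamma_2)$. Then, for all $\rho>0$ and $\mu\in\mathcal M_L$, the integral $J_\rho(\mu)$ is almost surely absolutely convergent and has finite mean; for all $\mu,\nu\in\mathcal M_L$ the integral $$C_Y(\mu,\nu)=\int_{\mathbb R^2\times\mathbb R_+^2}\left(\int_{[x_1-\frac{u_1}2,x_1+\frac{u_1}2]^2}f_\mu(y_1,x_2)\,f_\nu(y_2,x_2)\,\mathrm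 d(y_1,y_2)\right)\frac{u_2^2f_2(u_2)}{u_1^{\gamma_1+1}}\,\mathrm d(x,u)$$ converges absolutely (its value does not depend on the choice of densities with the above properties); and there is a centred Gaussian random field $(Y(\mu))_{\mu\in\mathcal M_L}$ with covariance function $C_Y$, linear in the sense that $Y(a\mu+b\nu)=aY(\mu)+bY(\nu)$ almost surely for all $a,b\in\mathbb R$ and $\mu,\nu\in\mathcal M_L$, such that $$\frac{\widetilde J_\rho(\cdot)}{\rho^{1-\eta/2}}\longrightarrow Y(\cdot)\qquad(\rho\downarrow0)$$ in finite-dimensional distributions on $\mathcal M_L$, i.e. for all $k$ and $\mu_1,\dots,\mu_k\in\mathcal M_L$ the random vectors $\rho^{-(1-\eta/2)}(\widetilde J_\rho(\mu_1),\dots,\widetilde J_\rho(\mu_k))$ converge in distribution to $(Y(\mu_1),\dots,Y(\mu_k))$. -/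

import Mathlib

open MeasureTheory ProbabilityTheory Filter Set Topology
open scoped ENNReal

noncomputable section

namespace RandomBoxes

/-- The closed axis-parallel box `B(x, u)` with centre `x` and edge lengths `u.1`, `u.2`. -/
def box (x u : ℝ × ℝ) : Set (ℝ × ℝ) :=
  Icc (x.1 - u.1 / 2) (x.1 + u.1 / 2) ×ˢ Icc (x.2 - u.2 / 2) (x.2 + u.2 / 2)

/-- `f` is a measurable function, nonnegative on the positive half-line, with
`f u ∼ 1 / u ^ (γ + 1)` as `u → ∞`. Values of `f` outside `(0, ∞)` are never used. -/
structure IsEdgeDensity (γ : ℝ) (f : ℝ → ℝ) : Prop where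
  measurable : Measurable f
  nonneg : ∀ u, 0 < u → 0 ≤ f u
  tail : Asymptotics.IsEquivalent atTop f (fun u => 1 / u ^ (γ + 1))

/-- The measure `F(du) = f₁(u₁) f₂(u₂) du₁ du₂` on `(0, ∞)²`, as a measure on the plane. -/
def edgeMeasure (f₁ f₂ : ℝ → ℝ) : Measure (ℝ × ℝ) :=
  (volume.restrict (Ioi 0 ×ˢ Ioi 0)).withDensity fun u => ENNReal.ofReal (f₁ u.1 * f₂ u.2)

/-- The intensity measure `l dx F_ρ(du)`, where `F_ρ` is the image of `F` under `u ↦ ρ u`. -/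
def intensity (l ρ : ℝ) (F : Measure (ℝ × ℝ)) : Measure ((ℝ × ℝ) × (ℝ × ℝ)) :=
  ENNReal.ofReal l • (volume : Measure (ℝ × ℝ)).prod (F.map fun u => ρ • u)

/-- `N` is a Poisson random measure with intensity measure `n`: the number of points in a set of
finite intensity is Poisson distributed, a set of infinite intensity contains infinitely many
points almost surely, and the numbers of points in disjoint sets are independent. -/
structure IsPoissonRandomMeasure {Ω E : Type*} [MeasurableSpace Ω] [MeasurableSpace E]
    (N : Ω → Measure E) (n : Measure E) (P : Measure Ω) : Prop where
  measurable : ∀ A, MeasurableSet A → Measurable fun ω => N ω A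
  map_eq : ∀ A, MeasurableSet A → n A ≠ ∞ →
    P.map (fun ω => N ω A) = (poissonMeasure (n A).toNNReal).map (fun k : ℕ => (k : ℝ≥0∞))
  eq_top : ∀ A, MeasurableSet A → n A = ∞ → ∀ᵐ ω ∂P, N ω A = ∞
  indep : ∀ (k : ℕ) (A : Fin k → Set E), (∀ i, MeasurableSet (A i)) →
    Pairwise (fun i j => Disjoint (A i) (A j)) → iIndepFun (fun i ω => N ω (A i)) P

/-- The cumulative volume `J(μ) = ∫ μ(B(x, u)) N(dx, du)`. -/
def cumVolume {Ω : Type*} (N : Ω → Measure ((ℝ × ℝ) × (ℝ × ℝ))) (μ : SignedMeasure (ℝ × ℝ))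
    (ω : Ω) : ℝ :=
  ∫ p, μ (box p.1 p.2) ∂(N ω)

/-- The centred field `J(μ) - 𝔼 J(μ)`. -/
def centredVolume {Ω : Type*} [MeasurableSpace Ω] (P : Measure Ω)
    (N : Ω → Measure ((ℝ × ℝ) × (ℝ × ℝ))) (μ : SignedMeasure (ℝ × ℝ)) (ω : Ω) : ℝ :=
  cumVolume N μ ω - ∫ ω', cumVolume N μ ω' ∂P

/-- `f` is a density of the signed measure `μ` which decays at least exponentially fast and whose
averages over thin horizontal boxes converge everywhere to its integrals over horizontal
segments. -/
structure IsLineDensity (f : ℝ × ℝ → ℝ) (μ : SignedMeasure (ℝ × ℝ)) : Prop where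
  measurable : Measurable f
  eq_withDensity : μ = (volume : Measure (ℝ × ℝ)).withDensityᵥ f
  decay : ∃ C > 0, ∃ c > 0, ∀ x, |f x| ≤ C * Real.exp (-c * (|x.1| + |x.2|))
  tendsto_line : ∀ (x : ℝ × ℝ) (u₁ : ℝ), 0 < u₁ →
    Tendsto (fun ε : ℝ => (1 / ε) * ∫ y in box x (u₁, ε), f y) (𝓝[>] 0)
      (𝓝 (∫ y₁ in Icc (x.1 - u₁ / 2) (x.1 + u₁ / 2), f (y₁, x.2)))

theorem integrable_of_decay {f : ℝ × ℝ → ℝ} (hf : Measurable f)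
    (h : ∃ C > 0, ∃ c > 0, ∀ x, |f x| ≤ C * Real.exp (-c * (|x.1| + |x.2|))) :
    Integrable f volume := by
  obtain ⟨C, -, c, hc, hb⟩ := h
  have h1 : Integrable (fun t : ℝ => Real.exp (-c * |t|)) volume := by
    rw [← integrableOn_univ, ← Iic_union_Ioi (a := (0 : ℝ))]
    refine IntegrableOn.union ?_ ?_
    · refine (integrableOn_exp_mul_Iic hc 0).congr_fun (fun t ht => ?_) measurableSet_Iic
      simp [abs_of_nonpos (mem_Iic.1 ht)]
    · refine (exp_neg_integrableOn_Ioi 0 hc).congr_fun (fun t ht => ?_) measurableSet_Ioi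
      simp [abs_of_pos (mem_Ioi.1 ht)]
  have h2 := (h1.mul_prod h1).const_mul C
  refine Integrable.mono' h2 hf.aestronglyMeasurable (ae_of_all _ fun x => ?_)
  refine (hb x).trans (le_of_eq ?_)
  rw [mul_add, Real.exp_add]

theorem IsLineDensity.integrable {f : ℝ × ℝ → ℝ} {μ : SignedMeasure (ℝ × ℝ)}
    (h : IsLineDensity f μ) : Integrable f volume :=
  integrable_of_decay h.measurable h.decay

theorem IsLineDensity.integrableOn_line {f : ℝ × ℝ → ℝ} {μ : SignedMeasure (ℝ × ℝ)}
    (h : IsLineDensity f μ) (t a b : ℝ) :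
    IntegrableOn (fun y => f (y, t)) (Icc a b) volume := by
  obtain ⟨C, hC, c, hc, hb⟩ := h.decay
  refine Measure.integrableOn_of_bounded (M := C) (by simp)
    (h.measurable.comp (measurable_id.prodMk measurable_const)).aestronglyMeasurable
    (ae_of_all _ fun y => (hb _).trans ?_)
  have : Real.exp (-c * (|y| + |t|)) ≤ 1 := by
    rw [Real.exp_le_one_iff]
    have : 0 ≤ c * (|y| + |t|) := by positivity
    linarith
  nlinarith

/-- The linear space `M_L` of signed measures on the plane which have such a density. -/
def lineSpace : Submodule ℝ (SignedMeasure (ℝ × ℝ)) where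
  carrier := {μ | ∃ f, IsLineDensity f μ}
  zero_mem' := by
    refine ⟨0, measurable_zero, by simp, ⟨1, one_pos, 1, one_pos, fun x => ?_⟩, ?_⟩
    · simp only [Pi.zero_apply, abs_zero]; positivity
    · intro x u₁ _
      simp
  add_mem' := by
    rintro μ ν ⟨f, hf⟩ ⟨g, hg⟩
    refine ⟨f + g, hf.measurable.add hg.measurable, ?_, ?_, ?_⟩
    · rw [withDensityᵥ_add hf.integrable hg.integrable, ← hf.eq_withDensity, ← hg.eq_withDensity]
    · obtain ⟨C, hC, c, hc, hb⟩ := hf.decay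
      obtain ⟨D, hD, d, hd, hb'⟩ := hg.decay
      refine ⟨C + D, by positivity, min c d, lt_min hc hd, fun x => ?_⟩
      have hx : 0 ≤ |x.1| + |x.2| := by positivity
      have e1 : Real.exp (-c * (|x.1| + |x.2|)) ≤ Real.exp (-(min c d) * (|x.1| + |x.2|)) :=
        Real.exp_le_exp.2 (by nlinarith [min_le_left c d])
      have e2 : Real.exp (-d * (|x.1| + |x.2|)) ≤ Real.exp (-(min c d) * (|x.1| + |x.2|)) :=
        Real.exp_le_exp.2 (by nlinarith [min_le_right c d])
      calc |(f + g) x| ≤ |f x| + |g x| := abs_add_le _ _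
        _ ≤ C * Real.exp (-c * (|x.1| + |x.2|)) + D * Real.exp (-d * (|x.1| + |x.2|)) :=
          add_le_add (hb x) (hb' x)
        _ ≤ _ := by rw [add_mul]; gcongr
    · intro x u₁ hu
      have h := (hf.tendsto_line x u₁ hu).add (hg.tendsto_line x u₁ hu)
      rw [← integral_add (hf.integrableOn_line _ _ _) (hg.integrableOn_line _ _ _)] at h
      refine h.congr fun ε => ?_
      rw [← mul_add, ← integral_add hf.integrable.integrableOn hg.integrable.integrableOn]
      rfl
  smul_mem' := by
    rintro a μ ⟨f, hf⟩
    refine ⟨a • f, hf.measurable.const_smul a, ?_, ?_, ?_⟩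
    · rw [withDensityᵥ_smul, ← hf.eq_withDensity]
    · obtain ⟨C, hC, c, hc, hb⟩ := hf.decay
      refine ⟨(|a| + 1) * C, by positivity, c, hc, fun x => ?_⟩
      have e := Real.exp_pos (-c * (|x.1| + |x.2|))
      have : |(a • f) x| = |a| * |f x| := by simp [abs_mul]
      rw [this, mul_assoc]
      have h0 := abs_nonneg (f x)
      have h1 := hb x
      nlinarith [abs_nonneg a]
    · intro x u₁ hu
      have h := (hf.tendsto_line x u₁ hu).const_mul a
      rw [← integral_const_mul] at h
      refine h.congr fun ε => ?_
      rw [mul_left_comm, ← integral_const_mul]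
      rfl

/-- The integrand, at `p = (x, u)`, of the covariance function of the limit. -/
def lineCovIntegrand (γ₁ : ℝ) (f₂ : ℝ → ℝ) (f g : ℝ × ℝ → ℝ) (p : (ℝ × ℝ) × (ℝ × ℝ)) : ℝ :=
  (∫ y in Icc (p.1.1 - p.2.1 / 2) (p.1.1 + p.2.1 / 2) ×ˢ
      Icc (p.1.1 - p.2.1 / 2) (p.1.1 + p.2.1 / 2), f (y.1, p.1.2) * g (y.2, p.1.2)) *
    (p.2.2 ^ 2 * f₂ p.2.2 / p.2.1 ^ (γ₁ + 1))

/-- The set `ℝ² × (0, ∞)²` of parameters `(x, u)` of boxes. -/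
def boxParams : Set ((ℝ × ℝ) × (ℝ × ℝ)) := univ ×ˢ (Ioi 0 ×ˢ Ioi 0)

/-- `Y` is a centred Gaussian linear random field on `M_L` whose covariance function at `(μ, ν)`
is the integral of `lineCovIntegrand` over `ℝ² × (0, ∞)²`, for whichever densities of `μ` and `ν`
as in `IsLineDensity`. -/
structure IsGaussianLineField {Ω : Type*} [MeasurableSpace Ω] (γ₁ : ℝ) (f₂ : ℝ → ℝ)
    (Y : lineSpace → Ω → ℝ) (P : Measure Ω) : Prop where
  gaussian : IsGaussianProcess Y P
  centred : ∀ μ, ∫ ω, Y μ ω ∂P = 0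
  linear : ∀ (a b : ℝ) (μ ν : lineSpace),
    ∀ᵐ ω ∂P, Y (a • μ + b • ν) ω = a * Y μ ω + b * Y ν ω
  covariance_eq : ∀ (μ ν : lineSpace) (f g : ℝ × ℝ → ℝ), IsLineDensity f μ → IsLineDensity g ν →
    covariance (Y μ) (Y ν) P = ∫ p in boxParams, lineCovIntegrand γ₁ f₂ f g p

end RandomBoxes

end

/-! The logarithm of the characteristic function of a centred Poisson integral is the integral of
exp(iw) - 1 - iw against the intensity (`charFun_centred_integral`). Both fields are almost surely
linear, so Cramér–Wold and Lévy's theorem reduce the convergence to a single measure with density f.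

Let v = ρ u₁ be the rescaled first edge and keep b = u₂, the second edge in units of ρ. The box has
width v and height ρb, and its mass m satisfies m/ρ → b · (integral of f over a segment). The
density λ ρ⁻¹ f₁(v/ρ) of v behaves like λ ρ^γ₁ v^(-γ₁-1), and w = m/ρ^(1-η/2) = ρ^(η/2) · m/ρ tends
to 0 because η > 0. A single box is thus negligible, exp(iw) - 1 - iw behaves like -w²/2, and λ
ρ^(γ₁+η) → 1 turns the integrand into -1/2 times the covariance integrand
(`tendsto_logCharIntegrand`). The limit is therefore Gaussian.

Domination combines the bound 3w² for the remainder, the power bound on f₁ and the exponential decay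
of f. Integrated over positions, this is a multiple of min(v, M) v · v^(-γ₁-1) · b² f₂(b), which is
integrable since 1 < γ₁ < 2 and γ₂ > 2 (`tendsto_integral_logCharIntegrand`).

The limit field exists because its covariance is an L² inner product of the functions `lineFeature`,
and every real Hilbert space carries an isonormal process (`exists_isonormal`). -/

namespace ProbabilityTheory

/-! ### Characteristic functions, isonormal processes and the Cramér–Wold device. -/

variable {Ω : Type*} [MeasurableSpace Ω] {P : Measure Ω}

theorem norm_exp_mul_I_sub_le (a b : ℝ) :
    ‖Complex.exp (a * Complex.I) - Complex.exp (b * Complex.I)‖ ≤ |a - b| := by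
  have h : Complex.exp (a * Complex.I) - Complex.exp (b * Complex.I) =
      Complex.exp (b * Complex.I) * (Complex.exp (Complex.I * ((a - b : ℝ) : ℂ)) - 1) := by
    rw [mul_sub, ← Complex.exp_add]
    push_cast
    ring_nf
  rw [h, norm_mul, Complex.norm_exp_ofReal_mul_I, one_mul]
  exact Real.norm_exp_I_mul_ofReal_sub_one_le

theorem charFun_map_eq_integral {X : Ω → ℝ} (hX : AEMeasurable X P) (t : ℝ) :
    charFun (P.map X) t = ∫ ω, Complex.exp ((t * X ω : ℝ) * Complex.I) ∂P := by
  rw [charFun_apply_real, integral_map hX (by fun_prop)]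
  simp

theorem integrable_exp_mul_I [IsFiniteMeasure P] {X : Ω → ℝ} (hX : AEMeasurable X P) :
    Integrable (fun ω => Complex.exp ((X ω : ℝ) * Complex.I)) P := by
  refine Integrable.of_bound (C := 1) (by fun_prop) (ae_of_all _ fun ω => ?_)
  rw [Complex.norm_exp_ofReal_mul_I]

/-- Characteristic functions are Lipschitz for the L¹ distance of the variables, so identities
between them pass to L¹ and L² limits. -/
theorem norm_charFun_map_sub_le [IsFiniteMeasure P] {X Y : Ω → ℝ} (hX : Integrable X P)
    (hY : Integrable Y P) (t : ℝ) :
    ‖charFun (P.map X) t - charFun (P.map Y) t‖ ≤ |t| * ∫ ω, |X ω - Y ω| ∂P := by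
  have hX' := hX.aemeasurable
  have hY' := hY.aemeasurable
  rw [charFun_map_eq_integral hX', charFun_map_eq_integral hY',
    ← integral_sub (integrable_exp_mul_I (by fun_prop)) (integrable_exp_mul_I (by fun_prop)),
    ← integral_const_mul]
  refine norm_integral_le_of_norm_le ((hX.sub hY).abs.const_mul _) (ae_of_all _ fun ω => ?_)
  refine (norm_exp_mul_I_sub_le _ _).trans (le_of_eq ?_)
  rw [← mul_sub, abs_mul]

theorem norm_charFun_map_sub_le_norm_Lp [IsProbabilityMeasure P] (X Y : Lp ℝ 2 P) (t : ℝ) :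
    ‖charFun (P.map X) t - charFun (P.map Y) t‖ ≤ |t| * ‖X - Y‖ := by
  have hX := (Lp.memLp X).integrable (by norm_num)
  have hY := (Lp.memLp Y).integrable (by norm_num)
  refine (norm_charFun_map_sub_le hX hY t).trans ?_
  gcongr
  have h : ∫ ω, |X ω - Y ω| ∂P = ∫ ω, ‖(X - Y : Lp ℝ 2 P) ω‖ ∂P :=
    integral_congr_ae <| by
      filter_upwards [Lp.coeFn_sub X Y] with ω hω
      rw [hω, Pi.sub_apply, Real.norm_eq_abs]
  rw [h, integral_norm_eq_lintegral_enorm (Lp.aestronglyMeasurable _), Lp.norm_def,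
    ← eLpNorm_one_eq_lintegral_enorm]
  exact ENNReal.toReal_mono (Lp.eLpNorm_ne_top _)
    (eLpNorm_le_eLpNorm_of_exponent_le (by norm_num) (Lp.aestronglyMeasurable _))

theorem continuous_charFun_map_Lp [IsProbabilityMeasure P] (t : ℝ) :
    Continuous fun X : Lp ℝ 2 P => charFun (P.map X) t := by
  refine (LipschitzWith.of_dist_le_mul (K := ‖t‖₊) fun X Y => ?_).continuous
  rw [dist_eq_norm, dist_eq_norm]
  exact norm_charFun_map_sub_le_norm_Lp X Y t

theorem charFun_sum_infinitePi_gaussianReal {ι : Type*} (s : Finset ι) (c : ι → ℝ) (t : ℝ) :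
    charFun ((Measure.infinitePi fun _ : ι => gaussianReal 0 1).map
      fun ω => ∑ i ∈ s, c i * ω i) t = Complex.exp (-(t ^ 2 * ∑ i ∈ s, c i ^ 2 / 2 : ℝ)) := by
  have hind := iIndepFun_infinitePi (P := fun _ : ι => gaussianReal 0 1)
    (X := fun i x => c i * x) (fun i => by fun_prop)
  have hi (i : ι) : Measurable fun ω : ι → ℝ => ω i := measurable_pi_apply i
  rw [iIndepFun.charFun_map_fun_finsetSum_eq_prod
    (fun i _ => ((hi i).const_mul _).aemeasurable) (hind.restrict _),
    Finset.prod_apply, Finset.mul_sum, Complex.ofReal_sum, ← Finset.sum_neg_distrib,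
    Complex.exp_sum]
  refine Finset.prod_congr rfl fun i _ => ?_
  rw [charFun_map_mul_comp (hi i).aemeasurable]
  have h : (Measure.infinitePi fun _ : ι => gaussianReal 0 1).map (fun ω : ι → ℝ => ω i) =
    gaussianReal 0 1 := (measurePreserving_eval_infinitePi _ i).map_eq
  rw [h, charFun_gaussianReal]
  push_cast
  ring_nf

/-- Every real Hilbert space is the index set of an isonormal Gaussian process. -/
theorem exists_isonormal (H : Type) [NormedAddCommGroup H] [InnerProductSpace ℝ H]
    [CompleteSpace H] :
    ∃ (Ω : Type) (_ : MeasurableSpace Ω) (P : Measure Ω) (_ : IsProbabilityMeasure P)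
      (Φ : H →ₗᵢ[ℝ] Lp ℝ 2 P), ∀ h, P.map (Φ h) = gaussianReal 0 (‖h‖₊ ^ 2) := by
  classical
  obtain ⟨ι, b, -⟩ := exists_hilbertBasis ℝ H
  let P : Measure (ι → ℝ) := Measure.infinitePi fun _ => gaussianReal 0 1
  have hmap (i : ι) := measurePreserving_eval_infinitePi (fun _ : ι => gaussianReal 0 1) i
  have hmem (i : ι) : MemLp (fun ω : ι → ℝ => ω i) 2 P :=
    (memLp_id_gaussianReal 2).comp_measurePreserving (hmap i)
  let ξ (i : ι) : Lp ℝ 2 P := (hmem i).toLp _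
  have hmean (i : ι) : ∫ ω, ω i ∂P = 0 := by
    have h := integral_map (μ := P) (φ := fun ω : ι → ℝ => ω i) (f := fun x : ℝ => x)
      (measurable_pi_apply i).aemeasurable (by fun_prop)
    rw [← h]
    exact (congrArg (fun m => ∫ x, x ∂m) (hmap i).map_eq).trans integral_id_gaussianReal
  -- Independent standard Gaussians attached to a Hilbert basis are orthonormal in L², so sending
  -- basis vectors to them extends to an isometry.
  have hξ : Orthonormal ℝ ξ := by
    rw [orthonormal_iff_ite]
    intro i j
    have h : inner ℝ (ξ i) (ξ j) = ∫ ω, ω i * ω j ∂P := by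
      rw [L2.inner_def]
      refine integral_congr_ae ?_
      filter_upwards [(hmem i).coeFn_toLp, (hmem j).coeFn_toLp] with ω h1 h2
      simp only [ξ]
      rw [h1, h2, real_inner_eq_re_inner, RCLike.inner_apply]
      simp [mul_comm]
    rw [h]
    split_ifs with hij
    · subst hij
      have h2 : ∫ ω, ω i * ω i ∂P = ∫ x, x ^ 2 ∂(gaussianReal 0 1) := by
        rw [← (hmap i).map_eq, integral_map (measurable_pi_apply i).aemeasurable (by fun_prop)]
        simp [sq, P]
      have h3 := variance_id_gaussianReal (μ := 0) (v := 1)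
      rw [variance_eq_integral (by fun_prop)] at h3
      rw [h2]
      simpa using h3
    · have hind := (iIndepFun_infinitePi (P := fun _ : ι => gaussianReal 0 1)
        (X := fun i x => x) (fun i => by fun_prop)).indepFun hij
      rw [hind.integral_fun_mul_eq_mul_integral (measurable_pi_apply i).aestronglyMeasurable
        (measurable_pi_apply j).aestronglyMeasurable]
      simp only [P] at hmean
      rw [hmean, zero_mul]
  refine ⟨ι → ℝ, inferInstance, P, inferInstance,
    hξ.orthogonalFamily.linearIsometry.comp b.repr.toLinearIsometry, fun h => ?_⟩
  -- The image of a vector is an L² limit of finite Gaussian sums, whose characteristic functions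
  -- converge by Parseval.
  refine Measure.ext_of_charFun (funext fun t => ?_)
  have hsum := hξ.orthogonalFamily.hasSum_linearIsometry (b.repr h)
  have h1 := ((continuous_charFun_map_Lp (P := P) t).tendsto _).comp hsum
  have hc : HasSum (fun i => b.repr h i ^ 2) (‖h‖ ^ 2) := by
    have := b.hasSum_inner_mul_inner h h
    rw [real_inner_self_eq_norm_sq] at this
    refine this.congr_fun fun i => ?_
    rw [b.repr_apply_apply, real_inner_comm (b i) h, sq]
  have h2 : Tendsto (fun s : Finset ι =>
      Complex.exp (-(t ^ 2 * ∑ i ∈ s, b.repr h i ^ 2 / 2 : ℝ))) atTop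
      (𝓝 (Complex.exp (-(t ^ 2 * (‖h‖ ^ 2 / 2) : ℝ)))) := by
    have : HasSum (fun i => b.repr h i ^ 2 / 2) (‖h‖ ^ 2 / 2) := hc.div_const 2
    have h3 : Continuous fun x : ℝ => Complex.exp (-(t ^ 2 * x : ℝ)) := by fun_prop
    exact (h3.tendsto _).comp this
  rw [charFun_gaussianReal]
  refine (tendsto_nhds_unique h1 (h2.congr fun s => ?_)).trans ?_
  · rw [← charFun_sum_infinitePi_gaussianReal]
    simp only [Function.comp_apply]
    congr 1
    refine Measure.map_congr ?_
    have h4 := Lp.coeFn_fun_finsetSum (p := 2) (μ := P) s (fun i => b.repr h i • ξ i)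
    have h5 : ∀ᵐ ω ∂P, ∀ i ∈ s, (b.repr h i • ξ i : Lp ℝ 2 P) ω = b.repr h i * ω i := by
      rw [Finset.eventually_all]
      intro i _
      filter_upwards [Lp.coeFn_smul (b.repr h i) (ξ i), (hmem i).coeFn_toLp] with ω h6 h7
      rw [h6, Pi.smul_apply, h7, smul_eq_mul]
    filter_upwards [h4, h5] with ω h6 h7
    rw [← Finset.sum_congr rfl h7, ← h6]
    rfl
  · push_cast
    congr 1
    simp
    ring

/-- Every map from a set into a real Hilbert space is the covariance structure of a centred
Gaussian process which respects linear relations. -/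
theorem exists_gaussianProcess {T H : Type} [NormedAddCommGroup H] [InnerProductSpace ℝ H]
    [CompleteSpace H] (h : T → H) :
    ∃ (Ω : Type) (_ : MeasurableSpace Ω) (P : Measure Ω) (_ : IsProbabilityMeasure P)
      (Y : T → Ω → ℝ), IsGaussianProcess Y P ∧
      (∀ t, P.map (Y t) = gaussianReal 0 (‖h t‖₊ ^ 2)) ∧
      (∀ s t, covariance (Y s) (Y t) P = inner ℝ (h s) (h t)) ∧
      ∀ (a b : ℝ) (s t u : T), h u = a • h s + b • h t →
        ∀ᵐ ω ∂P, Y u ω = a * Y s ω + b * Y t ω := by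
  classical
  obtain ⟨Ω, mΩ, P, hP, Φ, hΦ⟩ := exists_isonormal H
  have hmeas (x : H) : Measurable (Φ x) := (Lp.stronglyMeasurable _).measurable
  refine ⟨Ω, mΩ, P, hP, fun t => Φ (h t), ⟨fun I => ⟨?_⟩⟩, fun t => hΦ _, fun s t => ?_,
    fun a b s t u hu => ?_⟩
  -- A linear functional of finitely many coordinates is the image under `Φ` of one vector, hence
  -- Gaussian.
  · refine isGaussian_of_map_eq_gaussianReal fun L => ⟨0, ‖∑ i : I, L (Pi.single i 1) • h i‖₊ ^ 2, ?_⟩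
    have hI : Measurable fun ω => I.restrict fun x => Φ (h x) ω :=
      measurable_pi_lambda _ fun i => hmeas _
    rw [← hΦ, Measure.map_map (by fun_prop) hI]
    refine Measure.map_congr ?_
    rw [map_sum]
    have h1 : ∀ᵐ ω ∂P, ∀ i : I, Φ (L (Pi.single i 1) • h i) ω = L (Pi.single i 1) * Φ (h i) ω := by
      rw [ae_all_iff]
      intro i
      rw [map_smul]
      filter_upwards [Lp.coeFn_smul (L (Pi.single i 1)) (Φ (h i))] with ω hω
      rw [hω, Pi.smul_apply, smul_eq_mul]
    filter_upwards [h1, Lp.coeFn_fun_finsetSum Finset.univ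
      fun i : I => Φ (L (Pi.single i 1) • h i)] with ω h2 h3
    rw [h3, Finset.sum_congr rfl fun i _ => h2 i, Function.comp_apply,
      ← L.coe_coe, LinearMap.pi_apply_eq_sum_univ]
    refine Finset.sum_congr rfl fun i _ => ?_
    have h4 : (fun j => if i = j then (1 : ℝ) else 0) = Pi.single i 1 := by
      ext j
      simp [Pi.single_apply, eq_comm]
    rw [smul_eq_mul, mul_comm, h4]
    rfl
  · have hmean (x : H) : ∫ ω, Φ x ω ∂P = 0 := by
      have h1 := integral_map (μ := P) (f := fun x : ℝ => x) (hmeas x).aemeasurable (by fun_prop)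
      rw [← h1, hΦ, integral_id_gaussianReal]
    rw [covariance, ← Φ.inner_map_map, L2.inner_def]
    refine integral_congr_ae (ae_of_all _ fun ω => ?_)
    simp only [hmean, sub_zero]
    rw [real_inner_eq_re_inner, RCLike.inner_apply]
    simp [mul_comm]
  · beta_reduce
    rw [hu, map_add, map_smul, map_smul]
    filter_upwards [Lp.coeFn_add (a • Φ (h s)) (b • Φ (h t)), Lp.coeFn_smul a (Φ (h s)),
      Lp.coeFn_smul b (Φ (h t))] with ω h1 h2 h3
    rw [h1, Pi.add_apply, h2, h3]
    rfl

theorem charFun_map_toLp {κ : Type*} [Fintype κ] {X : Ω → κ → ℝ} (hX : AEMeasurable X P)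
    (t : EuclideanSpace ℝ κ) :
    charFun (P.map fun ω => WithLp.toLp 2 (X ω)) t =
      charFun (P.map fun ω => ∑ j, t j * X ω j) 1 := by
  rw [charFun_map_eq_integral (by fun_prop), charFun_apply,
    integral_map (by fun_prop) (by fun_prop)]
  simp [PiLp.inner_apply]

/-- The Cramér–Wold device combined with Lévy's continuity theorem. -/
theorem tendstoInDistribution_of_tendsto_charFun {ι κ Ω' : Type*} [Fintype κ] {Ω : ι → Type*}
    [∀ i, MeasurableSpace (Ω i)] {P : ∀ i, Measure (Ω i)} [∀ i, IsProbabilityMeasure (P i)]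
    [MeasurableSpace Ω'] {P' : Measure Ω'} [IsProbabilityMeasure P'] {l : Filter ι}
    [l.IsCountablyGenerated] {X : ∀ i, Ω i → κ → ℝ} {Z : Ω' → κ → ℝ}
    (hX : ∀ i, AEMeasurable (X i) (P i)) (hZ : AEMeasurable Z P')
    (h : ∀ t : κ → ℝ, Tendsto (fun i => charFun ((P i).map fun ω => ∑ j, t j * X i ω j) 1) l
      (𝓝 (charFun (P'.map fun ω => ∑ j, t j * Z ω j) 1))) :
    TendstoInDistribution X l Z P P' := by
  have h1 : TendstoInDistribution (fun i ω => WithLp.toLp 2 (X i ω)) l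
      (fun ω => WithLp.toLp 2 (Z ω)) P P' := by
    refine ⟨fun i => by have := hX i; fun_prop, by fun_prop, ?_⟩
    -- Countable generation of `l` allows testing along sequences, where Lévy's theorem applies.
    refine tendsto_of_seq_tendsto fun u hu => ?_
    refine ProbabilityMeasure.tendsto_of_tendsto_charFun fun t => ?_
    have h2 := (h t).comp hu
    rw [← charFun_map_toLp hZ] at h2
    refine h2.congr fun n => ?_
    exact (charFun_map_toLp (hX _) t).symm
  exact h1.continuous_comp (g := WithLp.ofLp) (by fun_prop)

end ProbabilityTheory

/-! ### Poisson random measures: Campbell's formula and characteristic functions of integrals. -/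

namespace ProbabilityTheory

theorem lintegral_natCast_poissonMeasure (r : NNReal) :
    ∫⁻ k, (k : ℝ≥0∞) ∂(poissonMeasure r) = r := by
  rw [lintegral_countable', tsum_eq_zero_add' ENNReal.summable]
  have h (k : ℕ) : ((k + 1 : ℕ) : ℝ≥0∞) * poissonMeasure r {k + 1} =
      r * poissonMeasure r {k} := by
    rw [poissonMeasure_singleton, poissonMeasure_singleton, ← ENNReal.ofReal_natCast,
      ← ENNReal.ofReal_coe_nnreal, ← ENNReal.ofReal_mul (by positivity),
      ← ENNReal.ofReal_mul (by positivity), Nat.factorial_succ]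
    congr 1
    push_cast
    field_simp
    ring
  have h1 : ∑' k, poissonMeasure r {k} = 1 := by
    simpa using (lintegral_countable' (μ := poissonMeasure r) (fun _ => (1 : ℝ≥0∞))).symm
  simp only [h, ENNReal.tsum_mul_left, h1]
  simp

end ProbabilityTheory

namespace RandomBoxes.IsPoissonRandomMeasure

variable {Ω E : Type*} [MeasurableSpace Ω] [MeasurableSpace E] {N : Ω → Measure E}
  {n : Measure E} {P : Measure Ω}

theorem measurable_measure (hN : IsPoissonRandomMeasure N n P) : Measurable N :=
  Measure.measurable_of_measurable_coe _ hN.measurable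

/-- The mean measure is the intensity, since a Poisson variable has its parameter as mean.
Campbell's formula follows by integrating against `P.bind N`. -/
theorem bind_eq [IsProbabilityMeasure P] (hN : IsPoissonRandomMeasure N n P) : P.bind N = n := by
  ext A hA
  rw [Measure.bind_apply hA hN.measurable_measure.aemeasurable]
  by_cases h : n A = ∞
  · rw [lintegral_congr_ae (hN.eq_top A hA h), h]
    simp
  · have h1 := lintegral_map (μ := P) (f := fun x => x) measurable_id (hN.measurable A hA)
    rw [← h1, hN.map_eq A hA h, lintegral_map (f := fun x => x) measurable_id (by fun_prop),
      lintegral_natCast_poissonMeasure, ENNReal.coe_toNNReal h]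

variable [IsProbabilityMeasure P]

theorem lintegral_lintegral (hN : IsPoissonRandomMeasure N n P) {g : E → ℝ≥0∞}
    (hg : Measurable g) : ∫⁻ ω, ∫⁻ x, g x ∂(N ω) ∂P = ∫⁻ x, g x ∂n := by
  rw [← Measure.lintegral_bind hN.measurable_measure.aemeasurable hg.aemeasurable, hN.bind_eq]

theorem ae_integrable (hN : IsPoissonRandomMeasure N n P) {g : E → ℝ} (hg : Measurable g)
    (hgi : Integrable g n) : ∀ᵐ ω ∂P, Integrable g (N ω) := by
  have hm : Measurable fun ω => ∫⁻ x, ‖g x‖ₑ ∂(N ω) :=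
    (Measure.measurable_lintegral hg.enorm).comp hN.measurable_measure
  have h : ∫⁻ ω, ∫⁻ x, ‖g x‖ₑ ∂(N ω) ∂P ≠ ∞ := by
    rw [hN.lintegral_lintegral hg.enorm]
    exact hgi.2.ne
  filter_upwards [ae_lt_top hm h] with ω hω
  exact ⟨hg.aestronglyMeasurable, hω⟩

theorem aemeasurable_integral (hN : IsPoissonRandomMeasure N n P) {g : E → ℝ} (hg : Measurable g)
    (hgi : Integrable g n) : AEMeasurable (fun ω => ∫ x, g x ∂(N ω)) P := by
  refine ⟨fun ω => (∫⁻ x, ENNReal.ofReal (g x) ∂(N ω)).toReal -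
    (∫⁻ x, ENNReal.ofReal (-g x) ∂(N ω)).toReal, ?_, ?_⟩
  · have h1 := (Measure.measurable_lintegral hg.ennreal_ofReal).comp hN.measurable_measure
    have h2 := (Measure.measurable_lintegral hg.neg.ennreal_ofReal).comp hN.measurable_measure
    exact h1.ennreal_toReal.sub h2.ennreal_toReal
  · filter_upwards [hN.ae_integrable hg hgi] with ω hω
    exact integral_eq_lintegral_pos_part_sub_lintegral_neg_part hω

theorem lintegral_enorm_integral_le (hN : IsPoissonRandomMeasure N n P) {g : E → ℝ}
    (hg : Measurable g) : ∫⁻ ω, ‖∫ x, g x ∂(N ω)‖ₑ ∂P ≤ ∫⁻ x, ‖g x‖ₑ ∂n := by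
  rw [← hN.lintegral_lintegral hg.enorm]
  exact lintegral_mono fun ω => enorm_integral_le_lintegral_enorm _

theorem integrable_integral (hN : IsPoissonRandomMeasure N n P) {g : E → ℝ} (hg : Measurable g)
    (hgi : Integrable g n) : Integrable (fun ω => ∫ x, g x ∂(N ω)) P :=
  ⟨(hN.aemeasurable_integral hg hgi).aestronglyMeasurable,
    (hN.lintegral_enorm_integral_le hg).trans_lt hgi.2⟩

theorem integral_integral (hN : IsPoissonRandomMeasure N n P) {g : E → ℝ} (hg : Measurable g)
    (hgi : Integrable g n) : ∫ ω, ∫ x, g x ∂(N ω) ∂P = ∫ x, g x ∂n := by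
  have aux {g : E → ℝ} (hg : Measurable g) (hgi : Integrable g n) :
      Integrable (fun ω => (∫⁻ x, ENNReal.ofReal (g x) ∂(N ω)).toReal) P ∧
      ∫ ω, (∫⁻ x, ENNReal.ofReal (g x) ∂(N ω)).toReal ∂P =
        (∫⁻ x, ENNReal.ofReal (g x) ∂n).toReal := by
    have hm : Measurable fun ω => ∫⁻ x, ENNReal.ofReal (g x) ∂(N ω) :=
      (Measure.measurable_lintegral hg.ennreal_ofReal).comp hN.measurable_measure
    have hl := hN.lintegral_lintegral hg.ennreal_ofReal
    have hfin : ∫⁻ x, ENNReal.ofReal (g x) ∂n ≠ ∞ :=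
      ((lintegral_mono fun x => Real.ofReal_le_enorm _).trans_lt hgi.2).ne
    rw [← hl] at hfin
    refine ⟨integrable_toReal_of_lintegral_ne_top hm.aemeasurable hfin, ?_⟩
    rw [integral_toReal hm.aemeasurable (ae_lt_top hm hfin), hl]
  have hneg := aux hg.neg hgi.neg
  simp only [Pi.neg_apply] at hneg
  rw [integral_eq_lintegral_pos_part_sub_lintegral_neg_part hgi, ← (aux hg hgi).2, ← hneg.2,
    ← integral_sub (aux hg hgi).1 hneg.1]
  refine integral_congr_ae ?_
  filter_upwards [hN.ae_integrable hg hgi] with ω hω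
  exact integral_eq_lintegral_pos_part_sub_lintegral_neg_part hω

omit [IsProbabilityMeasure P] in
theorem charFun_map_toReal (hN : IsPoissonRandomMeasure N n P) {A : Set E} (hA : MeasurableSet A)
    (hA' : n A ≠ ∞) (t : ℝ) :
    charFun (P.map fun ω => (N ω A).toReal) t =
      Complex.exp (n.real A * (Complex.exp (t * Complex.I) - 1)) := by
  have h : P.map (fun ω => (N ω A).toReal) =
      (poissonMeasure (n A).toNNReal).map (Nat.cast : ℕ → ℝ) := by
    have h1 := Measure.map_map (μ := P) ENNReal.measurable_toReal (hN.measurable A hA)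
    rw [hN.map_eq A hA hA', Measure.map_map ENNReal.measurable_toReal (by fun_prop)] at h1
    refine h1.symm.trans ?_
    congr 1
  rw [h, charFun_map_cast_poissonMeasure]
  rfl

omit [IsProbabilityMeasure P] in
theorem integrable_exp_sub_one {g : E → ℝ} (hg : Integrable g n) (t : ℝ) :
    Integrable (fun x => Complex.exp ((t * g x : ℝ) * Complex.I) - 1) n := by
  have hg' := hg.aestronglyMeasurable
  refine (hg.const_mul t).norm.mono' (by fun_prop) (ae_of_all _ fun x => ?_)
  simpa using norm_exp_mul_I_sub_le (t * g x) 0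

/-- The integral is a linear combination of the counts on the level sets, which are independent
Poisson variables, so the characteristic function factorises. -/
theorem charFun_integral_simpleFunc (hN : IsPoissonRandomMeasure N n P) (f : SimpleFunc E ℝ)
    (hf : Integrable f n) (t : ℝ) :
    charFun (P.map fun ω => ∫ x, f x ∂(N ω)) t =
      Complex.exp (∫ x, (Complex.exp ((t * f x : ℝ) * Complex.I) - 1) ∂n) := by
  have hrhs : ∫ x, (Complex.exp ((t * f x : ℝ) * Complex.I) - 1) ∂n =
      ∑ y ∈ f.range, n.real (f ⁻¹' {y}) * (Complex.exp ((t * y : ℝ) * Complex.I) - 1) := by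
    have h := SimpleFunc.map_integral f
      (fun y : ℝ => Complex.exp ((t * y : ℝ) * Complex.I) - 1) hf (by simp)
    rw [SimpleFunc.integral_eq_integral _ (by
      simpa [Function.comp_def] using integrable_exp_sub_one hf t)] at h
    simpa using h
  let e := f.range.equivFin.symm
  let A (i : Fin f.range.card) : Set E := f ⁻¹' {(e i : ℝ)}
  have hA (i) : MeasurableSet (A i) := f.measurableSet_preimage _
  have hdisj : Pairwise fun i j => Disjoint (A i) (A j) := fun i j hij =>
    Disjoint.preimage _ (by simpa [Subtype.ext_iff] using fun h => hij (e.injective (Subtype.ext h)))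
  have hind := (hN.indep _ A hA hdisj).comp (fun i x => x.toReal * (e i : ℝ)) (fun i => by fun_prop)
  have hlhs : (fun ω => ∫ x, f x ∂(N ω)) =ᵐ[P] fun ω => ∑ i, (N ω (A i)).toReal * (e i : ℝ) := by
    filter_upwards [hN.ae_integrable f.measurable hf] with ω hω
    rw [SimpleFunc.integral_eq_sum f hω, ← Finset.sum_coe_sort, ← e.sum_comp]
    rfl
  have hm (i) : Measurable fun ω => (N ω (A i)).toReal := (hN.measurable _ (hA i)).ennreal_toReal
  rw [Measure.map_congr hlhs, iIndepFun.charFun_map_fun_sum_eq_prod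
    (X := fun i ω => (N ω (A i)).toReal * (e i : ℝ))
    (fun i => ((hm i).mul_const _).aemeasurable) hind, Finset.prod_apply, hrhs,
    ← Finset.sum_coe_sort, ← e.sum_comp, Complex.exp_sum]
  refine Finset.prod_congr rfl fun i _ => ?_
  simp only [mul_comm _ (e i : ℝ)]
  rw [charFun_map_mul_comp (hm i).aemeasurable]
  -- The level set of the value 0 may have infinite intensity, but its factor is 1. All other level
  -- sets have finite intensity.
  by_cases hi : (e i : ℝ) = 0
  · have h1 : P.map (fun ω => (N ω (A i)).toReal) Set.univ = 1 := by
      rw [Measure.map_apply (hm i) MeasurableSet.univ]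
      simp
    simp [hi, Measure.real, h1]
  · rw [hN.charFun_map_toReal (hA i), mul_comm (e i : ℝ) t]
    exact (SimpleFunc.measure_preimage_lt_top_of_integrable f hf hi).ne

/-- Simple functions approximate `g` in L¹(n), and both sides are L¹-continuous: the left by
Campbell's formula, the right because t ↦ exp(it) is 1-Lipschitz. -/
theorem charFun_integral (hN : IsPoissonRandomMeasure N n P) {g : E → ℝ} (hg : Measurable g)
    (hgi : Integrable g n) (t : ℝ) :
    charFun (P.map fun ω => ∫ x, g x ∂(N ω)) t =
      Complex.exp (∫ x, (Complex.exp ((t * g x : ℝ) * Complex.I) - 1) ∂n) := by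
  let f := SimpleFunc.approxOn g hg (range g ∪ {0}) 0 (by simp)
  have hf (k) : Integrable (f k) n := SimpleFunc.integrable_approxOn_range hg hgi k
  have hfg : Tendsto (fun k => ∫ x, |f k x - g x| ∂n) atTop (𝓝 0) := by
    have h : Tendsto (fun k => ∫⁻ x, ‖(f k - g : E → ℝ) x‖ₑ ∂n) atTop (𝓝 0) :=
      SimpleFunc.tendsto_approxOn_range_L1_enorm hg hgi
    have h' := (ENNReal.tendsto_toReal ENNReal.zero_ne_top).comp h
    refine h'.congr fun k => ?_
    rw [Function.comp_apply,
      ← integral_norm_eq_lintegral_enorm ((hf k).sub hgi).aestronglyMeasurable]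
    rfl
  have h1 : Tendsto (fun k => charFun (P.map fun ω => ∫ x, f k x ∂(N ω)) t) atTop
      (𝓝 (charFun (P.map fun ω => ∫ x, g x ∂(N ω)) t)) := by
    rw [tendsto_iff_norm_sub_tendsto_zero]
    refine squeeze_zero (fun _ => norm_nonneg _) (fun k => ?_)
      (by simpa using hfg.const_mul |t|)
    refine (norm_charFun_map_sub_le (hN.integrable_integral (f k).measurable (hf k))
      (hN.integrable_integral hg hgi) t).trans ?_
    gcongr
    have h2 := hN.lintegral_enorm_integral_le ((f k).measurable.sub hg)
    have h3 := ENNReal.toReal_mono ((hf k).sub hgi).2.ne h2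
    rw [← integral_norm_eq_lintegral_enorm ((hf k).sub hgi).aestronglyMeasurable,
      ← integral_norm_eq_lintegral_enorm (hN.aemeasurable_integral ((f k).measurable.sub hg)
        ((hf k).sub hgi)).aestronglyMeasurable] at h3
    refine (le_of_eq (integral_congr_ae ?_)).trans h3
    filter_upwards [hN.ae_integrable (f k).measurable (hf k), hN.ae_integrable hg hgi]
      with ω h4 h5
    rw [Real.norm_eq_abs]
    simp only [Pi.sub_apply]
    rw [integral_sub h4 h5]
  have h2 : Tendsto (fun k => ∫ x, (Complex.exp ((t * f k x : ℝ) * Complex.I) - 1) ∂n) atTop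
      (𝓝 (∫ x, (Complex.exp ((t * g x : ℝ) * Complex.I) - 1) ∂n)) := by
    rw [tendsto_iff_norm_sub_tendsto_zero]
    refine squeeze_zero (fun _ => norm_nonneg _) (fun k => ?_)
      (by simpa using hfg.const_mul |t|)
    rw [← integral_sub (integrable_exp_sub_one (hf k) t) (integrable_exp_sub_one hgi t),
      ← integral_const_mul]
    refine norm_integral_le_of_norm_le (((hf k).sub hgi).abs.const_mul _) (ae_of_all _ fun x => ?_)
    rw [sub_sub_sub_cancel_right]
    refine (norm_exp_mul_I_sub_le _ _).trans (le_of_eq ?_)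
    rw [← mul_sub, abs_mul]
  refine tendsto_nhds_unique h1 (((Complex.continuous_exp.tendsto _).comp h2).congr fun k => ?_)
  exact (hN.charFun_integral_simpleFunc (f k) (hf k) t).symm

theorem charFun_centred_integral (hN : IsPoissonRandomMeasure N n P) {g : E → ℝ}
    (hg : Measurable g) (hgi : Integrable g n) (t : ℝ) :
    charFun (P.map fun ω => ∫ x, g x ∂(N ω) - ∫ ω', ∫ x, g x ∂(N ω') ∂P) t =
      Complex.exp (∫ x, (Complex.exp ((t * g x : ℝ) * Complex.I) - 1 -
        (t * g x : ℝ) * Complex.I) ∂n) := by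
  have hm := hN.aemeasurable_integral hg hgi
  have h0 := hN.charFun_integral hg hgi t
  have h1 : Integrable (fun x => ((t * g x : ℝ) : ℂ) * Complex.I) n :=
    (hgi.const_mul t).ofReal.mul_const _
  rw [charFun_map_eq_integral hm] at h0
  rw [integral_sub (integrable_exp_sub_one hgi t) h1, Complex.exp_sub, ← h0,
    charFun_map_eq_integral (by fun_prop), hN.integral_integral hg hgi, integral_mul_const,
    integral_complex_ofReal, integral_const_mul, ← integral_div]
  refine integral_congr_ae (ae_of_all _ fun ω => ?_)
  simp only []
  rw [← Complex.exp_sub, mul_sub]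
  push_cast
  ring_nf

end RandomBoxes.IsPoissonRandomMeasure

/-! ### Masses of intervals under the exponential envelope. -/

noncomputable section

namespace RandomBoxes

theorem integrable_exp_neg_mul_abs {c : ℝ} (hc : 0 < c) :
    Integrable (fun t : ℝ => Real.exp (-c * |t|)) volume := by
  rw [← integrableOn_univ, ← Iic_union_Ioi (a := (0 : ℝ))]
  refine IntegrableOn.union ?_ ?_
  · refine (integrableOn_exp_mul_Iic hc 0).congr_fun (fun t ht => ?_) measurableSet_Iic
    simp [abs_of_nonpos (mem_Iic.1 ht)]
  · refine (exp_neg_integrableOn_Ioi 0 hc).congr_fun (fun t ht => ?_) measurableSet_Ioi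
    simp [abs_of_pos (mem_Ioi.1 ht)]

/-- The mass of the interval of length `r` around `t` for the density `exp (-c |y|)`. -/
def expMass (c t r : ℝ) : ℝ := ∫ y in Icc (t - r / 2) (t + r / 2), Real.exp (-c * |y|)

/-- The total mass of the density `exp (-c |y|)`. -/
def expTotal (c : ℝ) : ℝ := ∫ y, Real.exp (-c * |y|)

theorem measurable_setIntegral_segment {α : Type*} [MeasurableSpace α] {g : α → ℝ → ℝ}
    (hg : Measurable (Function.uncurry g)) {a b : α → ℝ} (ha : Measurable a) (hb : Measurable b) :
    Measurable fun x => ∫ y in Icc (a x) (b x), g x y := by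
  have hs : MeasurableSet {p : α × ℝ | p.2 ∈ Icc (a p.1) (b p.1)} :=
    (measurableSet_le (ha.comp measurable_fst) measurable_snd).inter
      (measurableSet_le measurable_snd (hb.comp measurable_fst))
  have h := ((hg.indicator hs).stronglyMeasurable.integral_prod_right' (ν := volume)).measurable
  convert h using 2 with x
  rw [← integral_indicator measurableSet_Icc]
  rfl

theorem measurable_expMass (c : ℝ) : Measurable fun p : ℝ × ℝ => expMass c p.1 p.2 :=
  measurable_setIntegral_segment (g := fun _ y => Real.exp (-c * |y|)) (by fun_prop) (by fun_prop)
    (by fun_prop)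

variable {c : ℝ}

theorem expMass_nonneg (c t r : ℝ) : 0 ≤ expMass c t r :=
  integral_nonneg fun _ => (Real.exp_pos _).le

theorem expTotal_nonneg (c : ℝ) : 0 ≤ expTotal c :=
  integral_nonneg fun _ => (Real.exp_pos _).le

theorem expMass_le_expTotal (hc : 0 < c) (t r : ℝ) : expMass c t r ≤ expTotal c :=
  setIntegral_le_integral (integrable_exp_neg_mul_abs hc) (ae_of_all _ fun _ => (Real.exp_pos _).le)

/-- On the interval |y| ≥ |t| - r/2. This keeps both the factor r and the decay in t, at the price
of an exponential factor in r. -/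
theorem expMass_le_mul_exp (hc : 0 < c) (t : ℝ) {r : ℝ} (hr : 0 ≤ r) :
    expMass c t r ≤ r * (Real.exp (c * r / 2) * Real.exp (-c * |t|)) := by
  have h : ∀ y ∈ Icc (t - r / 2) (t + r / 2),
      Real.exp (-c * |y|) ≤ Real.exp (c * r / 2) * Real.exp (-c * |t|) := fun y hy => by
    rw [← Real.exp_add, Real.exp_le_exp]
    have h1 : |t| ≤ |y| + r / 2 := by
      have h2 : |t - y| ≤ r / 2 := abs_le.2 ⟨by linarith [hy.2], by linarith [hy.1]⟩
      linarith [abs_sub_abs_le_abs_sub t y]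
    nlinarith
  refine (setIntegral_mono_on (integrable_exp_neg_mul_abs hc).integrableOn
    (integrableOn_const (by simp))
    measurableSet_Icc h).trans (le_of_eq ?_)
  rw [setIntegral_const, Measure.real, Real.volume_Icc, smul_eq_mul, ENNReal.toReal_ofReal]
  · ring
  · linarith

theorem expMass_le (hc : 0 < c) (t : ℝ) {r : ℝ} (hr : 0 ≤ r) : expMass c t r ≤ r := by
  have h : ∀ y ∈ Icc (t - r / 2) (t + r / 2), Real.exp (-c * |y|) ≤ 1 := fun y _ => by
    rw [Real.exp_le_one_iff]
    have := mul_nonneg hc.le (abs_nonneg y)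
    linarith
  refine (setIntegral_mono_on (integrable_exp_neg_mul_abs hc).integrableOn
    (integrableOn_const (by simp))
    measurableSet_Icc h).trans (le_of_eq ?_)
  rw [setIntegral_const, Measure.real, Real.volume_Icc, smul_eq_mul, ENNReal.toReal_ofReal]
  · ring
  · linarith

theorem integrable_expMass (hc : 0 < c) {r : ℝ} (hr : 0 ≤ r) :
    Integrable (fun t => expMass c t r) := by
  refine ((integrable_exp_neg_mul_abs hc).const_mul (r * Real.exp (c * r / 2))).mono'
    ((measurable_expMass c).comp (measurable_id.prodMk measurable_const)).aestronglyMeasurable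
    (ae_of_all _ fun t => ?_)
  rw [Real.norm_of_nonneg (expMass_nonneg _ _ _), mul_assoc]
  exact expMass_le_mul_exp hc t hr

theorem integral_expMass (hc : 0 < c) {r : ℝ} (hr : 0 ≤ r) :
    ∫ t, expMass c t r = r * expTotal c := by
  have h1 (t : ℝ) : expMass c t r = ∫ y in Icc (-(r / 2)) (r / 2), Real.exp (-c * |y + t|) := by
    rw [expMass, integral_Icc_eq_integral_Ioc, integral_Icc_eq_integral_Ioc,
      ← intervalIntegral.integral_of_le (by linarith),
      ← intervalIntegral.integral_of_le (by linarith),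
      intervalIntegral.integral_comp_add_right (fun y => Real.exp (-c * |y|))]
    ring_nf
  have hi := integrable_exp_neg_mul_abs hc
  have h2 : Integrable (Function.uncurry fun t y => Real.exp (-c * |y + t|))
      (volume.prod (volume.restrict (Icc (-(r / 2)) (r / 2)))) := by
    refine (integrable_prod_iff' (by fun_prop)).2 ⟨ae_of_all _ fun y => ?_, ?_⟩
    · simpa [add_comm] using hi.comp_add_left y
    · simp only [Function.uncurry_apply_pair, Real.norm_eq_abs, Real.abs_exp]
      simp only [integral_add_left_eq_self (fun t => Real.exp (-c * |t|))]
      simp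
  simp only [h1]
  rw [integral_integral_swap h2]
  simp only [integral_add_left_eq_self (fun t => Real.exp (-c * |t|))]
  rw [setIntegral_const, Measure.real, Real.volume_Icc, smul_eq_mul, ENNReal.toReal_ofReal]
  · rw [expTotal]
    ring
  · linarith

theorem integrable_expMass_sq (hc : 0 < c) {r : ℝ} (hr : 0 ≤ r) :
    Integrable (fun t => expMass c t r ^ 2) := by
  refine ((integrable_expMass hc hr).const_mul r).mono'
    (((measurable_expMass c).comp (measurable_id.prodMk measurable_const)).pow_const
      2).aestronglyMeasurable (ae_of_all _ fun t => ?_)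
  have h := expMass_nonneg c t r
  rw [Real.norm_of_nonneg (by positivity), sq]
  exact mul_le_mul_of_nonneg_right (expMass_le hc t hr) h

/-- One factor is bounded uniformly and the other integrated exactly. The bound is quadratic for
small r and linear for large r, which suits the range 1 < γ₁ < 2. -/
theorem integral_expMass_sq_le (hc : 0 < c) {r : ℝ} (hr : 0 ≤ r) :
    ∫ t, expMass c t r ^ 2 ≤ min r (expTotal c) * (r * expTotal c) := by
  rw [← integral_expMass hc hr, ← integral_const_mul]
  refine integral_mono (integrable_expMass_sq hc hr) ((integrable_expMass hc hr).const_mul _)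
    fun t => ?_
  simp only [sq]
  exact mul_le_mul_of_nonneg_right (le_min (expMass_le hc t hr) (expMass_le_expTotal hc t r))
    (expMass_nonneg c t r)

end RandomBoxes

end

/-! ### Box masses, line masses and moments of the edge densities. -/

noncomputable section

namespace RandomBoxes

/-- The volume of the box with parameters `p` for the density `f`. -/
def boxMass (f : ℝ × ℝ → ℝ) (p : (ℝ × ℝ) × (ℝ × ℝ)) : ℝ := ∫ y in box p.1 p.2, f y

/-- The integral of `f` over the horizontal segment of length `v` with midpoint `x`. -/
def lineMass (f : ℝ × ℝ → ℝ) (x : ℝ × ℝ) (v : ℝ) : ℝ :=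
  ∫ y in Icc (x.1 - v / 2) (x.1 + v / 2), f (y, x.2)

variable {f g : ℝ × ℝ → ℝ} {μ ν : SignedMeasure (ℝ × ℝ)} {C c : ℝ}

theorem measurableSet_box (x u : ℝ × ℝ) : MeasurableSet (box x u) :=
  measurableSet_Icc.prod measurableSet_Icc

theorem IsLineDensity.measure_box (h : IsLineDensity f μ) (p : (ℝ × ℝ) × (ℝ × ℝ)) :
    μ (box p.1 p.2) = boxMass f p := by
  rw [h.eq_withDensity, withDensityᵥ_apply h.integrable (measurableSet_box _ _)]
  rfl

theorem measurable_boxMass (hf : Measurable f) : Measurable (boxMass f) := by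
  have hs : MeasurableSet {q : ((ℝ × ℝ) × (ℝ × ℝ)) × (ℝ × ℝ) | q.2 ∈ box q.1.1 q.1.2} := by
    have : {q : ((ℝ × ℝ) × (ℝ × ℝ)) × (ℝ × ℝ) | q.2 ∈ box q.1.1 q.1.2} =
        ({q | q.1.1.1 - q.1.2.1 / 2 ≤ q.2.1} ∩ {q | q.2.1 ≤ q.1.1.1 + q.1.2.1 / 2}) ∩
        ({q | q.1.1.2 - q.1.2.2 / 2 ≤ q.2.2} ∩ {q | q.2.2 ≤ q.1.1.2 + q.1.2.2 / 2}) := rfl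
    rw [this]
    refine ((measurableSet_le ?_ ?_).inter (measurableSet_le ?_ ?_)).inter
      ((measurableSet_le ?_ ?_).inter (measurableSet_le ?_ ?_)) <;> fun_prop
  have h := (((hf.comp measurable_snd).indicator hs).stronglyMeasurable.integral_prod_right'
    (ν := (volume : Measure (ℝ × ℝ)))).measurable
  convert h using 2 with p
  rw [boxMass, ← integral_indicator (measurableSet_box _ _)]
  rfl

theorem measurable_lineMass (hf : Measurable f) :
    Measurable fun p : (ℝ × ℝ) × ℝ => lineMass f p.1 p.2 :=
  measurable_setIntegral_segment (g := fun (p : (ℝ × ℝ) × ℝ) y => f (y, p.1.2)) (by fun_prop)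
    (by fun_prop) (by fun_prop)

theorem abs_boxMass_le (hc : 0 < c) (hf : ∀ x, |f x| ≤ C * Real.exp (-c * (|x.1| + |x.2|)))
    (p : (ℝ × ℝ) × (ℝ × ℝ)) :
    |boxMass f p| ≤ C * (expMass c p.1.1 p.2.1 * expMass c p.1.2 p.2.2) := by
  have h := (integrable_exp_neg_mul_abs hc).mul_prod (integrable_exp_neg_mul_abs hc)
  have h1 := norm_integral_le_of_norm_le (f := f) (h.integrableOn (s := box p.1 p.2) |>.const_mul C)
    (ae_of_all _ fun x => (hf x).trans (le_of_eq (by rw [mul_add, Real.exp_add])))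
  refine h1.trans (le_of_eq ?_)
  rw [integral_const_mul, box, setIntegral_prod_mul (fun y => Real.exp (-c * |y|))
    (fun y => Real.exp (-c * |y|))]
  rfl

theorem abs_lineMass_le (hc : 0 < c) (hf : ∀ x, |f x| ≤ C * Real.exp (-c * (|x.1| + |x.2|)))
    (x : ℝ × ℝ) (v : ℝ) :
    |lineMass f x v| ≤ C * (expMass c x.1 v * Real.exp (-c * |x.2|)) := by
  have h := ((integrable_exp_neg_mul_abs hc).mul_const (Real.exp (-c * |x.2|))).const_mul C
  have h1 := norm_integral_le_of_norm_le (f := fun y => f (y, x.2))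
    (h.integrableOn (s := Icc (x.1 - v / 2) (x.1 + v / 2)))
    (ae_of_all _ fun y => (hf (y, x.2)).trans (le_of_eq (by rw [mul_add, Real.exp_add])))
  refine h1.trans (le_of_eq ?_)
  rw [integral_const_mul, integral_mul_const]
  rfl

theorem lineCovIntegrand_eq (γ : ℝ) (f₂ : ℝ → ℝ) (f g : ℝ × ℝ → ℝ) (p : (ℝ × ℝ) × (ℝ × ℝ)) :
    lineCovIntegrand γ f₂ f g p = lineMass f p.1 p.2.1 * lineMass g p.1 p.2.1 *
      (p.2.2 ^ 2 * f₂ p.2.2 / p.2.1 ^ (γ + 1)) := by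
  rw [lineCovIntegrand, Measure.volume_eq_prod,
    setIntegral_prod_mul (fun y => f (y, p.1.2)) (fun y => g (y, p.1.2))]
  rfl

theorem IsLineDensity.tendsto_boxMass (h : IsLineDensity f μ) (x : ℝ × ℝ) {v : ℝ} (hv : 0 < v) :
    Tendsto (fun ε : ℝ => boxMass f (x, (v, ε)) / ε) (𝓝[>] 0) (𝓝 (lineMass f x v)) := by
  refine (h.tendsto_line x v hv).congr fun ε => ?_
  rw [one_div, inv_mul_eq_div]
  rfl

/-- Segments are null sets, so almost everywhere equality of the densities would not suffice. But
line masses are limits of normalised box masses, which depend on the measure alone. -/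
theorem IsLineDensity.lineMass_unique (hf : IsLineDensity f μ) (hg : IsLineDensity g μ)
    (x : ℝ × ℝ) {v : ℝ} (hv : 0 < v) : lineMass f x v = lineMass g x v := by
  refine tendsto_nhds_unique (hf.tendsto_boxMass x hv) ((hg.tendsto_boxMass x hv).congr fun ε => ?_)
  rw [← hf.measure_box, ← hg.measure_box]

section EdgeDensity

variable {γ γ₁ γ₂ : ℝ} {f₁ f₂ : ℝ → ℝ}

theorem IsEdgeDensity.eventually_le (h : IsEdgeDensity γ f₁) :
    ∀ᶠ u in atTop, f₁ u ≤ 2 * u ^ (-(γ + 1)) := by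
  obtain ⟨φ, hφ, hfφ⟩ := h.tail.exists_eq_mul
  filter_upwards [hφ.eventually_le_const (by norm_num : (1 : ℝ) < 2), hfφ, eventually_gt_atTop 0]
    with u h1 h2 h3
  rw [h2, Pi.mul_apply, one_div, ← Real.rpow_neg h3.le]
  gcongr

theorem IsEdgeDensity.integrableOn_pow_mul (h : IsEdgeDensity γ f₁)
    (hi : IntegrableOn f₁ (Ioi 0)) {k : ℕ} (hk : (k : ℝ) < γ) :
    IntegrableOn (fun u => u ^ k * f₁ u) (Ioi 0) := by
  have hm := h.measurable
  obtain ⟨T, hT⟩ := eventually_atTop.1 (h.eventually_le.and (eventually_gt_atTop 0))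
  have hT0 : 0 < T := (hT T le_rfl).2
  rw [← Ioc_union_Ioi_eq_Ioi hT0.le]
  refine IntegrableOn.union ?_ ?_
  · refine ((hi.mono_set Ioc_subset_Ioi_self).const_mul (T ^ k)).mono'
      (by fun_prop) ((ae_restrict_iff' measurableSet_Ioc).2 (ae_of_all _ fun u hu => ?_))
    have h1 := h.nonneg u hu.1
    have h2 := hu.1.le
    rw [Real.norm_of_nonneg (by positivity)]
    gcongr
    exact hu.2
  · have h1 := (integrableOn_Ioi_rpow_of_lt (a := k - (γ + 1)) (by linarith) hT0).const_mul 2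
    refine h1.mono' (by fun_prop)
      ((ae_restrict_iff' measurableSet_Ioi).2 (ae_of_all _ fun u (hu : T < u) => ?_))
    have hu0 := hT0.trans hu
    have h2 := h.nonneg u hu0
    have h3 := (hT u hu.le).1
    rw [Real.norm_of_nonneg (by positivity), sub_eq_add_neg, Real.rpow_add hu0, Real.rpow_natCast]
    calc u ^ k * f₁ u ≤ u ^ k * (2 * u ^ (-(γ + 1))) := by gcongr
      _ = _ := by ring

theorem IsEdgeDensity.integrableOn (h₁ : IsEdgeDensity γ₁ f₁) (h₂ : IsEdgeDensity γ₂ f₂)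
    (hF : IsProbabilityMeasure (edgeMeasure f₁ f₂)) :
    IntegrableOn f₁ (Ioi 0) ∧ IntegrableOn f₂ (Ioi 0) := by
  have hm1 := h₁.measurable
  have hm2 := h₂.measurable
  have h := hF.measure_univ
  rw [edgeMeasure, withDensity_apply _ MeasurableSet.univ, Measure.restrict_univ,
    Measure.volume_eq_prod, ← Measure.prod_restrict] at h
  have h1 : ∫⁻ u, ENNReal.ofReal (f₁ u.1 * f₂ u.2)
      ∂((volume.restrict (Ioi 0)).prod (volume.restrict (Ioi 0))) =
      (∫⁻ u in Ioi 0, ENNReal.ofReal (f₁ u)) * ∫⁻ u in Ioi 0, ENNReal.ofReal (f₂ u) := by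
    rw [← lintegral_prod_mul (by fun_prop) (by fun_prop)]
    refine lintegral_congr_ae ?_
    rw [Measure.prod_restrict]
    refine (ae_restrict_iff' (measurableSet_Ioi.prod measurableSet_Ioi)).2
      (ae_of_all _ fun u hu => ?_)
    exact ENNReal.ofReal_mul (h₁.nonneg _ hu.1)
  rw [h1] at h
  have hne (φ : ℝ → ℝ) (hφ : Measurable φ) (h0 : ∀ u, 0 < u → 0 ≤ φ u)
      (hfin : ∫⁻ u in Ioi 0, ENNReal.ofReal (φ u) ≠ ∞) : IntegrableOn φ (Ioi 0) := by
    refine ⟨by fun_prop, ?_⟩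
    rw [hasFiniteIntegral_iff_ofReal
      ((ae_restrict_iff' measurableSet_Ioi).2 (ae_of_all _ fun u hu => h0 u hu))]
    exact hfin.lt_top
  refine ⟨hne _ hm1 h₁.nonneg fun ht => ?_, hne _ hm2 h₂.nonneg fun ht => ?_⟩
  -- An infinite factor would make the total mass 0 or ∞ instead of 1.
  · rw [ht] at h
    by_cases h0 : ∫⁻ u in Ioi 0, ENNReal.ofReal (f₂ u) = 0
    · simp [h0] at h
    · simp [ENNReal.top_mul h0] at h
  · rw [ht] at h
    by_cases h0 : ∫⁻ u in Ioi 0, ENNReal.ofReal (f₁ u) = 0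
    · simp [h0] at h
    · simp [ENNReal.mul_top h0] at h

/-- Near 0 the integrand is at most v^(1-γ), integrable since γ < 2; at infinity it is at most M
v^(-γ), integrable since γ > 1. -/
theorem integrableOn_min_mul_div_rpow (M : ℝ) (hM : 0 ≤ M) (hγ : γ ∈ Ioo (1 : ℝ) 2) :
    IntegrableOn (fun v : ℝ => min v M * v / v ^ (γ + 1)) (Ioi 0) := by
  have hm : Measurable fun v : ℝ => min v M * v / v ^ (γ + 1) := by fun_prop
  rw [← Ioc_union_Ioi_eq_Ioi zero_le_one]
  refine IntegrableOn.union ?_ ?_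
  · have h1 : IntegrableOn (fun v : ℝ => v ^ (1 - γ)) (Ioc 0 1) := by
      rw [← intervalIntegrable_iff_integrableOn_Ioc_of_le zero_le_one]
      exact intervalIntegral.intervalIntegrable_rpow' (by linarith [hγ.2])
    refine h1.mono' hm.aestronglyMeasurable
      ((ae_restrict_iff' measurableSet_Ioc).2 (ae_of_all _ fun v hv => ?_))
    have h0 := hv.1
    rw [Real.norm_of_nonneg (by positivity), show 1 - γ = 2 - (γ + 1) by ring, Real.rpow_sub h0,
      Real.rpow_two, sq]
    gcongr
    exact min_le_left _ _
  · refine ((integrableOn_Ioi_rpow_of_lt (a := -γ) (by linarith [hγ.1]) one_pos).const_mul M).mono'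
      hm.aestronglyMeasurable ((ae_restrict_iff' measurableSet_Ioi).2
      (ae_of_all _ fun v (hv : 1 < v) => ?_))
    have h0 : 0 < v := one_pos.trans hv
    have h2 : M * v ^ (-γ) = M * v / v ^ (γ + 1) := by
      rw [Real.rpow_neg h0.le, Real.rpow_add_one h0.ne']
      field_simp
    rw [Real.norm_of_nonneg (by positivity), h2]
    gcongr
    exact min_le_right _ _

end EdgeDensity

end RandomBoxes

end

/-! ### Integration over box parameters and against the intensity. -/

noncomputable section

namespace RandomBoxes

variable {V : Type*} [NormedAddCommGroup V]

theorem measurableSet_boxParams : MeasurableSet boxParams :=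
  MeasurableSet.univ.prod (measurableSet_Ioi.prod measurableSet_Ioi)

theorem volume_restrict_boxParams : volume.restrict boxParams =
    (volume : Measure (ℝ × ℝ)).prod (volume.restrict (Ioi (0 : ℝ) ×ˢ Ioi (0 : ℝ))) := by
  rw [boxParams, Measure.volume_eq_prod, ← Measure.prod_restrict, Measure.restrict_univ]

theorem ae_restrict_quadrant {p : ℝ × ℝ → Prop} (h : ∀ u v, 0 < u → 0 < v → p (u, v)) :
    ∀ᵐ u ∂(volume.restrict (Ioi (0 : ℝ) ×ˢ Ioi (0 : ℝ))), p u :=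
  (ae_restrict_iff' (measurableSet_Ioi.prod measurableSet_Ioi)).2
    (ae_of_all _ fun u hu => h u.1 u.2 hu.1 hu.2)

theorem integrableOn_quadrant_mul {k₁ k₂ : ℝ → ℝ} (h₁ : IntegrableOn k₁ (Ioi 0))
    (h₂ : IntegrableOn k₂ (Ioi 0)) :
    IntegrableOn (fun u : ℝ × ℝ => k₁ u.1 * k₂ u.2) (Ioi 0 ×ˢ Ioi 0) := by
  rw [IntegrableOn, Measure.volume_eq_prod, ← Measure.prod_restrict]
  exact h₁.mul_prod h₂

theorem integrableOn_boxParams {G : (ℝ × ℝ) × (ℝ × ℝ) → V} (hG : StronglyMeasurable G)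
    (hi : ∀ u v, 0 < u → 0 < v → Integrable fun x => G (x, (u, v))) {k₁ k₂ : ℝ → ℝ}
    (h₁ : IntegrableOn k₁ (Ioi 0)) (h₂ : IntegrableOn k₂ (Ioi 0))
    (hk : ∀ u v, 0 < u → 0 < v → ∫ x, ‖G (x, (u, v))‖ ≤ k₁ u * k₂ v) :
    IntegrableOn G boxParams := by
  rw [IntegrableOn, volume_restrict_boxParams, integrable_prod_iff' hG.aestronglyMeasurable]
  refine ⟨ae_restrict_quadrant hi, (integrableOn_quadrant_mul h₁ h₂).mono' ?_ ?_⟩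
  · exact hG.norm.integral_prod_left'.aestronglyMeasurable
  · refine ae_restrict_quadrant fun u v hu hv => ?_
    rw [Real.norm_of_nonneg (integral_nonneg fun _ => norm_nonneg _)]
    exact hk u v hu hv

/-- Dominated convergence, first in the position and then in the edge lengths of a box. -/
theorem tendsto_setIntegral_boxParams [NormedSpace ℝ V] {l : Filter ℝ} [l.IsCountablyGenerated]
    {G : ℝ → (ℝ × ℝ) × (ℝ × ℝ) → V} {G₀ : (ℝ × ℝ) × (ℝ × ℝ) → V}
    (hG : ∀ ρ, StronglyMeasurable (G ρ)) (hi : ∀ᶠ ρ in l, IntegrableOn (G ρ) boxParams)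
    (hi₀ : IntegrableOn G₀ boxParams)
    (hx : ∀ u v, 0 < u → 0 < v → ∃ h : ℝ × ℝ → ℝ, Integrable h ∧
      ∀ᶠ ρ in l, ∀ x, ‖G ρ (x, (u, v))‖ ≤ h x)
    {k₁ k₂ : ℝ → ℝ} (h₁ : IntegrableOn k₁ (Ioi 0)) (h₂ : IntegrableOn k₂ (Ioi 0))
    (hk : ∀ᶠ ρ in l, ∀ u v, 0 < u → 0 < v → ∫ x, ‖G ρ (x, (u, v))‖ ≤ k₁ u * k₂ v)
    (hlim : ∀ x u v, 0 < u → 0 < v →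
      Tendsto (fun ρ => G ρ (x, (u, v))) l (𝓝 (G₀ (x, (u, v))))) :
    Tendsto (fun ρ => ∫ p in boxParams, G ρ p) l (𝓝 (∫ p in boxParams, G₀ p)) := by
  rw [IntegrableOn, volume_restrict_boxParams] at hi₀
  simp only [IntegrableOn, volume_restrict_boxParams] at hi ⊢
  rw [integral_prod_symm _ hi₀]
  have hev : ∀ᶠ ρ in l, ∫ u in Ioi (0 : ℝ) ×ˢ Ioi (0 : ℝ), ∫ x, G ρ (x, u) = ∫ p, G ρ p
      ∂((volume : Measure (ℝ × ℝ)).prod (volume.restrict (Ioi (0 : ℝ) ×ˢ Ioi (0 : ℝ)))) := by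
    filter_upwards [hi] with ρ hρ
    rw [integral_prod_symm _ hρ]
  refine Tendsto.congr' hev ?_
  refine tendsto_integral_filter_of_dominated_convergence _ (Eventually.of_forall fun ρ =>
    (hG ρ).integral_prod_left'.aestronglyMeasurable) ?_ (integrableOn_quadrant_mul h₁ h₂) ?_
  · filter_upwards [hk] with ρ hρ
    exact ae_restrict_quadrant fun u v hu hv =>
      (norm_integral_le_integral_norm _).trans (hρ u v hu hv)
  · refine ae_restrict_quadrant fun u v hu hv => ?_
    obtain ⟨h, hh, hb⟩ := hx u v hu hv
    refine tendsto_integral_filter_of_dominated_convergence h (Eventually.of_forall fun ρ => ?_)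
      ?_ hh (ae_of_all _ fun x => hlim x u v hu hv)
    · exact ((hG ρ).comp_measurable (measurable_id.prodMk measurable_const)).aestronglyMeasurable
    · filter_upwards [hb] with ρ hρ using ae_of_all _ hρ

/-- The change of parameters which multiplies the first edge length by `ρ`. -/
def scaleWidth (ρ : ℝ) (p : (ℝ × ℝ) × (ℝ × ℝ)) : (ℝ × ℝ) × (ℝ × ℝ) :=
  (p.1, (ρ * p.2.1, p.2.2))

theorem measurable_scaleWidth (ρ : ℝ) : Measurable (scaleWidth ρ) := by
  unfold scaleWidth
  fun_prop

theorem map_restrict_Ioi_mul_left {ρ : ℝ} (hρ : 0 < ρ) :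
    (volume.restrict (Ioi (0 : ℝ))).map (ρ * ·) =
      ENNReal.ofReal ρ⁻¹ • volume.restrict (Ioi (0 : ℝ)) := by
  have h : (ρ * ·) ⁻¹' (Ioi (0 : ℝ)) = Ioi 0 := by
    ext x
    simp [hρ]
  have h1 := Measure.restrict_map (μ := volume) (f := fun x : ℝ => ρ * x) (by fun_prop)
    (measurableSet_Ioi (a := (0 : ℝ)))
  rw [h] at h1
  rw [← h1, Real.map_volume_mul_left hρ.ne', Measure.restrict_smul, abs_of_pos (inv_pos.2 hρ)]

theorem map_scaleWidth {ρ : ℝ} (hρ : 0 < ρ) :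
    (volume.restrict boxParams).map (scaleWidth ρ) =
      ENNReal.ofReal ρ⁻¹ • volume.restrict boxParams := by
  have h : scaleWidth ρ = Prod.map id (Prod.map (ρ * ·) id) := rfl
  rw [volume_restrict_boxParams, Measure.volume_eq_prod ℝ ℝ, ← Measure.prod_restrict, h,
    ← Measure.map_prod_map _ _ measurable_id (by fun_prop),
    ← Measure.map_prod_map _ _ (by fun_prop) measurable_id, map_restrict_Ioi_mul_left hρ,
    Measure.map_id, Measure.map_id, Measure.prod_smul_left, Measure.prod_smul_right]

theorem integral_comp_scaleWidth [NormedSpace ℝ V] {G : (ℝ × ℝ) × (ℝ × ℝ) → V}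
    (hG : StronglyMeasurable G) {ρ : ℝ} (hρ : 0 < ρ) :
    ∫ p in boxParams, G (scaleWidth ρ p) = ρ⁻¹ • ∫ p in boxParams, G p := by
  rw [← integral_map (measurable_scaleWidth ρ).aemeasurable hG.aestronglyMeasurable,
    map_scaleWidth hρ, integral_smul_measure, ENNReal.toReal_ofReal (by positivity)]

section Intensity

variable [NormedSpace ℝ V] {f₁ f₂ : ℝ → ℝ} {l ρ : ℝ}

theorem intensity_eq (hf₁ : Measurable f₁) (hf₂ : Measurable f₂) :
    intensity l ρ (edgeMeasure f₁ f₂) = ENNReal.ofReal l •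
      ((volume.restrict boxParams).withDensity fun p =>
        ENNReal.ofReal (f₁ p.2.1 * f₂ p.2.2)).map (fun p => (p.1, ρ • p.2)) := by
  have : SFinite (edgeMeasure f₁ f₂) := by
    unfold edgeMeasure
    infer_instance
  have h : (volume : Measure (ℝ × ℝ)).prod ((edgeMeasure f₁ f₂).map fun u => ρ • u) =
      ((volume : Measure (ℝ × ℝ)).prod (edgeMeasure f₁ f₂)).map (Prod.map id fun u => ρ • u) := by
    rw [← Measure.map_prod_map _ _ measurable_id (by fun_prop), Measure.map_id]
  rw [intensity, h, edgeMeasure, prod_withDensity_right (by fun_prop),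
    volume_restrict_boxParams]
  rfl

theorem ae_boxParams_toReal (h₁ : ∀ u, 0 < u → 0 ≤ f₁ u) (h₂ : ∀ u, 0 < u → 0 ≤ f₂ u)
    (G : (ℝ × ℝ) × (ℝ × ℝ) → V) :
    (fun p => (ENNReal.ofReal (f₁ p.2.1 * f₂ p.2.2)).toReal • G p)
      =ᵐ[volume.restrict boxParams] fun p => (f₁ p.2.1 * f₂ p.2.2) • G p := by
  refine (ae_restrict_iff' measurableSet_boxParams).2 (ae_of_all _ fun p hp => ?_)
  simp only []
  rw [ENNReal.toReal_ofReal (mul_nonneg (h₁ _ hp.2.1) (h₂ _ hp.2.2))]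

theorem integrable_intensity {γ₁ γ₂ : ℝ} (h₁ : IsEdgeDensity γ₁ f₁) (h₂ : IsEdgeDensity γ₂ f₂)
    {G : (ℝ × ℝ) × (ℝ × ℝ) → V} (hG : StronglyMeasurable G)
    (hi : IntegrableOn (fun p => (f₁ p.2.1 * f₂ p.2.2) • G (p.1, ρ • p.2)) boxParams) :
    Integrable G (intensity l ρ (edgeMeasure f₁ f₂)) := by
  have hm1 := h₁.measurable
  have hm2 := h₂.measurable
  rw [intensity_eq hm1 hm2]
  refine Integrable.smul_measure ?_ ENNReal.ofReal_ne_top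
  rw [integrable_map_measure hG.aestronglyMeasurable (by fun_prop),
    integrable_withDensity_iff_integrable_smul' (by fun_prop) (by simp)]
  exact hi.congr (ae_boxParams_toReal h₁.nonneg h₂.nonneg _).symm

theorem integral_intensity {γ₁ γ₂ : ℝ} (h₁ : IsEdgeDensity γ₁ f₁) (h₂ : IsEdgeDensity γ₂ f₂)
    {G : (ℝ × ℝ) × (ℝ × ℝ) → V} (hG : StronglyMeasurable G) (hl : 0 ≤ l) :
    ∫ p, G p ∂(intensity l ρ (edgeMeasure f₁ f₂)) =
      l • ∫ p in boxParams, (f₁ p.2.1 * f₂ p.2.2) • G (p.1, ρ • p.2) := by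
  have hm1 := h₁.measurable
  have hm2 := h₂.measurable
  rw [intensity_eq hm1 hm2, integral_smul_measure, ENNReal.toReal_ofReal hl,
    integral_map (by fun_prop) hG.aestronglyMeasurable,
    integral_withDensity_eq_integral_toReal_smul (by fun_prop) (by simp)]
  rw [integral_congr_ae (ae_boxParams_toReal h₁.nonneg h₂.nonneg _)]

end Intensity

end RandomBoxes

end

/-! ### The exponential remainder and integrability of box masses and covariances. -/

noncomputable section

namespace RandomBoxes

/-- The second order remainder `exp (i w) - 1 - i w` of the exponential function. -/
def expRemainder (w : ℝ) : ℂ := Complex.exp (w * Complex.I) - 1 - w * Complex.I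

theorem measurable_expRemainder : Measurable expRemainder := by
  unfold expRemainder
  fun_prop

/-- Taylor's bound covers |w| ≤ 1; beyond that the triangle inequality gives 2 + |w| ≤ 3w². -/
theorem norm_expRemainder_le (w : ℝ) : ‖expRemainder w‖ ≤ 3 * w ^ 2 := by
  have hn : ‖(w : ℂ) * Complex.I‖ = |w| := by simp
  rcases le_total |w| 1 with h | h
  · have h1 := Complex.norm_exp_sub_one_sub_id_le (x := w * Complex.I) (by rwa [hn])
    rw [hn, sq_abs] at h1
    exact h1.trans (by nlinarith [sq_nonneg w])
  · calc ‖expRemainder w‖ ≤ ‖Complex.exp (w * Complex.I)‖ + ‖(1 : ℂ)‖ + ‖(w : ℂ) * Complex.I‖ :=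
          (norm_sub_le _ _).trans (by gcongr; exact norm_sub_le _ _)
      _ = 1 + 1 + |w| := by rw [Complex.norm_exp_ofReal_mul_I, hn, norm_one]
      _ ≤ 3 * w ^ 2 := by nlinarith [sq_abs w]

theorem norm_expRemainder_add_le {w : ℝ} (h : |w| ≤ 1) :
    ‖expRemainder w + w ^ 2 / 2‖ ≤ |w| ^ 3 := by
  have hn : ‖(w : ℂ) * Complex.I‖ = |w| := by simp
  have h1 := Complex.exp_bound (x := w * Complex.I) (by rwa [hn]) (n := 3) (by norm_num)
  rw [hn] at h1
  have h2 : expRemainder w + w ^ 2 / 2 = Complex.exp (w * Complex.I) -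
      ∑ m ∈ Finset.range 3, ((w : ℂ) * Complex.I) ^ m / (m.factorial : ℂ) := by
    simp [expRemainder, Finset.sum_range_succ, mul_pow]
    ring
  rw [h2]
  refine h1.trans ?_
  have h3 : 0 ≤ |w| ^ 3 := by positivity
  norm_num [Nat.factorial]
  linarith

theorem tendsto_expRemainder_div {ι : Type*} {l : Filter ι} {d z : ι → ℝ} {z₀ : ℝ}
    (hd : Tendsto d l (𝓝 0)) (hd' : ∀ᶠ i in l, d i ≠ 0) (hz : Tendsto z l (𝓝 z₀)) :
    Tendsto (fun i => expRemainder (d i * z i) / (d i : ℂ) ^ 2) l (𝓝 (-(z₀ : ℂ) ^ 2 / 2)) := by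
  have h1 : Tendsto (fun i => -(z i : ℂ) ^ 2 / 2) l (𝓝 (-(z₀ : ℂ) ^ 2 / 2)) :=
    (((Complex.continuous_ofReal.tendsto _).comp hz).pow 2).neg.div_const 2
  have h2 : Tendsto (fun i => expRemainder (d i * z i) / (d i : ℂ) ^ 2 - (-(z i : ℂ) ^ 2 / 2)) l
      (𝓝 0) := by
    have hb : Tendsto (fun i => |d i| * |z i| ^ 3) l (𝓝 0) := by
      simpa using hd.abs.mul (hz.abs.pow 3)
    refine squeeze_zero_norm' ?_ hb
    have hs : Tendsto (fun i => |d i * z i|) l (𝓝 0) := by simpa using (hd.mul hz).abs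
    filter_upwards [hs.eventually_le_const one_pos, hd'] with i hi hdi
    have hdi' : (d i : ℂ) ≠ 0 := by exact_mod_cast hdi
    have h3 : expRemainder (d i * z i) / (d i : ℂ) ^ 2 - (-(z i : ℂ) ^ 2 / 2) =
        (expRemainder (d i * z i) + ((d i * z i : ℝ) : ℂ) ^ 2 / 2) / (d i : ℂ) ^ 2 := by
      push_cast
      field_simp
      ring
    have h4 : 0 < |d i| := abs_pos.2 hdi
    rw [h3, norm_div, norm_pow, Complex.norm_real, Real.norm_eq_abs, div_le_iff₀ (by positivity)]
    refine (norm_expRemainder_add_le hi).trans (le_of_eq ?_)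
    rw [abs_mul]
    ring
  simpa using h2.add h1

section Integrability

variable {f g : ℝ × ℝ → ℝ} {μ ν : SignedMeasure (ℝ × ℝ)} {γ γ₁ γ₂ : ℝ} {f₁ f₂ : ℝ → ℝ}

theorem integrable_boxMass_intensity (hf : IsLineDensity f μ) (h₁ : IsEdgeDensity γ₁ f₁)
    (h₂ : IsEdgeDensity γ₂ f₂) (hγ₁ : 1 < γ₁) (hγ₂ : 1 < γ₂)
    (hF : IsProbabilityMeasure (edgeMeasure f₁ f₂)) {ρ : ℝ} (hρ : 0 < ρ) (l : ℝ) :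
    Integrable (boxMass f) (intensity l ρ (edgeMeasure f₁ f₂)) := by
  obtain ⟨C, hC, c, hc, hb⟩ := hf.decay
  obtain ⟨i₁, i₂⟩ := h₁.integrableOn h₂ hF
  have hm := measurable_boxMass hf.measurable
  have hm1 := h₁.measurable
  have hm2 := h₂.measurable
  refine integrable_intensity h₁ h₂ hm.stronglyMeasurable ?_
  have hG : Measurable fun p : (ℝ × ℝ) × (ℝ × ℝ) =>
      (f₁ p.2.1 * f₂ p.2.2) • boxMass f (p.1, ρ • p.2) := by fun_prop
  have hbd (u v : ℝ) (hu : 0 < u) (hv : 0 < v) (x : ℝ × ℝ) :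
      ‖(f₁ u * f₂ v) • boxMass f (x, ρ • (u, v))‖ ≤
        f₁ u * f₂ v * C * (expMass c x.1 (ρ * u) * expMass c x.2 (ρ * v)) := by
    have h1 := h₁.nonneg u hu
    have h2 := h₂.nonneg v hv
    rw [norm_smul, Real.norm_of_nonneg (by positivity), mul_assoc (f₁ u * f₂ v)]
    exact mul_le_mul_of_nonneg_left (abs_boxMass_le hc hb _) (by positivity)
  have hint (u v : ℝ) (hu : 0 < u) (hv : 0 < v) : Integrable fun x : ℝ × ℝ =>
      f₁ u * f₂ v * C * (expMass c x.1 (ρ * u) * expMass c x.2 (ρ * v)) :=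
    ((integrable_expMass hc (by positivity)).mul_prod
      (integrable_expMass hc (by positivity))).const_mul _
  have hk₁ := (h₁.integrableOn_pow_mul i₁ (k := 1) (by simpa using hγ₁)).const_mul
    (C * ρ ^ 2 * expTotal c ^ 2)
  have hk₂ := h₂.integrableOn_pow_mul i₂ (k := 1) (by simpa using hγ₂)
  refine integrableOn_boxParams hG.stronglyMeasurable (fun u v hu hv => ?_) hk₁ hk₂
    fun u v hu hv => ?_
  · exact (hint u v hu hv).mono' (by fun_prop) (ae_of_all _ (hbd u v hu hv))
  · refine (integral_mono_of_nonneg (ae_of_all _ fun _ => norm_nonneg _) (hint u v hu hv)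
      (ae_of_all _ (hbd u v hu hv))).trans (le_of_eq ?_)
    rw [integral_const_mul, Measure.volume_eq_prod,
      integral_prod_mul (fun y => expMass c y (ρ * u)) (fun y => expMass c y (ρ * v)),
      integral_expMass hc (by positivity), integral_expMass hc (by positivity)]
    ring

theorem measurable_lineCovIntegrand (hf : Measurable f) (hg : Measurable g) (hf₂ : Measurable f₂) :
    Measurable (lineCovIntegrand γ f₂ f g) := by
  have h1 := (measurable_lineMass hf).comp
    (measurable_fst.prodMk measurable_snd.fst : Measurable fun p : (ℝ × ℝ) × (ℝ × ℝ) => (p.1, p.2.1))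
  have h2 := (measurable_lineMass hg).comp
    (measurable_fst.prodMk measurable_snd.fst : Measurable fun p : (ℝ × ℝ) × (ℝ × ℝ) => (p.1, p.2.1))
  simp only [funext (lineCovIntegrand_eq γ f₂ f g)]
  exact (h1.mul h2).mul (by fun_prop)

theorem integrableOn_lineCovIntegrand_self (hf : IsLineDensity f μ) (h₂ : IsEdgeDensity γ₂ f₂)
    (hγ : γ ∈ Ioo (1 : ℝ) 2) (hγ₂ : 2 < γ₂) (i₂ : IntegrableOn f₂ (Ioi 0)) :
    IntegrableOn (lineCovIntegrand γ f₂ f f) boxParams := by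
  obtain ⟨C, hC, c, hc, hb⟩ := hf.decay
  have hm := measurable_lineCovIntegrand (γ := γ) hf.measurable hf.measurable h₂.measurable
  have he : Integrable fun y : ℝ => Real.exp (-c * |y|) ^ 2 := by
    refine (integrable_exp_neg_mul_abs (c := 2 * c) (by positivity)).congr (ae_of_all _ fun y => ?_)
    simp only []
    rw [← Real.exp_nat_mul]
    push_cast
    ring_nf
  have hbd (u v : ℝ) (hu : 0 < u) (hv : 0 < v) (x : ℝ × ℝ) :
      ‖lineCovIntegrand γ f₂ f f (x, (u, v))‖ ≤ C ^ 2 * (v ^ 2 * f₂ v / u ^ (γ + 1)) *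
        (expMass c x.1 u ^ 2 * Real.exp (-c * |x.2|) ^ 2) := by
    have h2 := h₂.nonneg v hv
    have h3 := abs_lineMass_le hc hb x u
    have h4 : 0 ≤ v ^ 2 * f₂ v / u ^ (γ + 1) := by positivity
    rw [lineCovIntegrand_eq, norm_mul, Real.norm_of_nonneg h4, ← sq,
      Real.norm_of_nonneg (sq_nonneg _), ← sq_abs]
    calc |lineMass f x u| ^ 2 * (v ^ 2 * f₂ v / u ^ (γ + 1))
        ≤ (C * (expMass c x.1 u * Real.exp (-c * |x.2|))) ^ 2 * (v ^ 2 * f₂ v / u ^ (γ + 1)) := by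
          gcongr
      _ = _ := by ring
  have hint (u v : ℝ) (hu : 0 < u) : Integrable fun x : ℝ × ℝ =>
      C ^ 2 * (v ^ 2 * f₂ v / u ^ (γ + 1)) *
        (expMass c x.1 u ^ 2 * Real.exp (-c * |x.2|) ^ 2) :=
    ((integrable_expMass_sq hc hu.le).mul_prod he).const_mul _
  have hk₁ := (integrableOn_min_mul_div_rpow (expTotal c) (expTotal_nonneg c) hγ).const_mul
    (C ^ 2 * expTotal c * ∫ y, Real.exp (-c * |y|) ^ 2)
  have hk₂ := h₂.integrableOn_pow_mul i₂ (k := 2) (by exact_mod_cast hγ₂)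
  refine integrableOn_boxParams hm.stronglyMeasurable (fun u v hu hv => ?_) hk₁ hk₂
    fun u v hu hv => ?_
  · exact (hint u v hu).mono' (hm.comp (by fun_prop)).aestronglyMeasurable
      (ae_of_all _ (hbd u v hu hv))
  · refine (integral_mono_of_nonneg (ae_of_all _ fun _ => norm_nonneg _) (hint u v hu)
      (ae_of_all _ (hbd u v hu hv))).trans ?_
    rw [integral_const_mul, Measure.volume_eq_prod,
      integral_prod_mul (fun y => expMass c y u ^ 2) (fun y => Real.exp (-c * |y|) ^ 2)]
    have h1 := integral_expMass_sq_le hc hu.le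
    have h2 := h₂.nonneg v hv
    have h3 : 0 ≤ ∫ y : ℝ, Real.exp (-c * |y|) ^ 2 := integral_nonneg fun _ => by positivity
    calc C ^ 2 * (v ^ 2 * f₂ v / u ^ (γ + 1)) *
          ((∫ y, expMass c y u ^ 2) * ∫ y, Real.exp (-c * |y|) ^ 2)
        ≤ C ^ 2 * (v ^ 2 * f₂ v / u ^ (γ + 1)) *
          ((min u (expTotal c) * (u * expTotal c)) * ∫ y, Real.exp (-c * |y|) ^ 2) := by gcongr
      _ = _ := by ring

theorem integrableOn_lineCovIntegrand (hf : IsLineDensity f μ) (hg : IsLineDensity g ν)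
    (h₂ : IsEdgeDensity γ₂ f₂) (hγ : γ ∈ Ioo (1 : ℝ) 2) (hγ₂ : 2 < γ₂)
    (i₂ : IntegrableOn f₂ (Ioi 0)) : IntegrableOn (lineCovIntegrand γ f₂ f g) boxParams := by
  have hm := measurable_lineCovIntegrand (γ := γ) hf.measurable hg.measurable h₂.measurable
  refine ((integrableOn_lineCovIntegrand_self hf h₂ hγ hγ₂ i₂).add
    (integrableOn_lineCovIntegrand_self hg h₂ hγ hγ₂ i₂)).mono' hm.aestronglyMeasurable
    ((ae_restrict_iff' measurableSet_boxParams).2 (ae_of_all _ fun p hp => ?_))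
  have h1 := h₂.nonneg _ hp.2.2
  have h2 : 0 < p.2.1 := hp.2.1
  have h4 : 0 ≤ p.2.2 ^ 2 * f₂ p.2.2 / p.2.1 ^ (γ + 1) := by positivity
  rw [Pi.add_apply]
  simp only [lineCovIntegrand_eq]
  rw [norm_mul, Real.norm_of_nonneg h4, ← add_mul]
  gcongr
  -- The mixed product is controlled by |ab| ≤ a² + b².
  rw [Real.norm_eq_abs, abs_le]
  constructor <;> nlinarith [sq_nonneg (lineMass f p.1 p.2.1 + lineMass g p.1 p.2.1),
    sq_nonneg (lineMass f p.1 p.2.1 - lineMass g p.1 p.2.1), sq_nonneg (lineMass f p.1 p.2.1),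
    sq_nonneg (lineMass g p.1 p.2.1)]

end Integrability

end RandomBoxes

end

/-! ### Convergence of the logarithm of the characteristic function. -/

noncomputable section

namespace RandomBoxes

variable {f : ℝ × ℝ → ℝ} {μ : SignedMeasure (ℝ × ℝ)} {γ γ₁ γ₂ η : ℝ} {f₁ f₂ : ℝ → ℝ}

theorem IsEdgeDensity.tendsto_mul_rpow (h : IsEdgeDensity γ f₁) :
    Tendsto (fun u => f₁ u * u ^ (γ + 1)) atTop (𝓝 1) := by
  obtain ⟨φ, hφ, hfφ⟩ := h.tail.exists_eq_mul
  refine hφ.congr' ?_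
  filter_upwards [hfφ, eventually_gt_atTop 0] with u h1 h2
  have := Real.rpow_pos_of_pos h2 (γ + 1)
  rw [h1, Pi.mul_apply]
  field_simp

/-- The integrand of the logarithm of the characteristic function of the rescaled field, with the
first edge length measured in the original scale and the second one in units of `ρ`. -/
def logCharIntegrand (η : ℝ) (f₁ f₂ : ℝ → ℝ) (f : ℝ × ℝ → ℝ) (l ρ : ℝ)
    (p : (ℝ × ℝ) × (ℝ × ℝ)) : ℂ :=
  (l * ρ⁻¹ * f₁ (p.2.1 / ρ) * f₂ p.2.2) •
    expRemainder ((ρ ^ (1 - η / 2))⁻¹ * boxMass f (p.1, (p.2.1, ρ * p.2.2)))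

theorem measurable_logCharIntegrand (hf : Measurable f) (h₁ : Measurable f₁) (h₂ : Measurable f₂)
    (l ρ : ℝ) : Measurable (logCharIntegrand η f₁ f₂ f l ρ) := by
  have hm := measurable_boxMass hf
  have hr := measurable_expRemainder
  unfold logCharIntegrand
  fun_prop

theorem integral_intensity_expRemainder (hf : IsLineDensity f μ) (h₁ : IsEdgeDensity γ₁ f₁)
    (h₂ : IsEdgeDensity γ₂ f₂) {l ρ : ℝ} (hl : 0 ≤ l) (hρ : 0 < ρ) :
    ∫ p, expRemainder ((ρ ^ (1 - η / 2))⁻¹ * boxMass f p)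
      ∂(intensity l ρ (edgeMeasure f₁ f₂)) =
      ∫ p in boxParams, logCharIntegrand η f₁ f₂ f l ρ p := by
  have hm := measurable_boxMass hf.measurable
  have hr := measurable_expRemainder
  have hL := measurable_logCharIntegrand (η := η) hf.measurable h₁.measurable h₂.measurable l ρ
  rw [integral_intensity h₁ h₂ (Measurable.stronglyMeasurable (by fun_prop)) hl,
    -- The inserted factor ρ⁻¹ is the Jacobian of the substitution v = ρ u₁.
    ← smul_inv_smul₀ hρ.ne' (∫ p in boxParams, logCharIntegrand η f₁ f₂ f l ρ p),
    ← integral_comp_scaleWidth hL.stronglyMeasurable hρ, ← integral_smul, ← integral_smul]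
  congr 1
  ext p
  simp only [logCharIntegrand, scaleWidth, smul_smul]
  rw [mul_div_cancel_left₀ _ hρ.ne']
  congr 1
  field_simp

/-- This explains the normalisation: with l = λ_ρ, y = f₁(v/ρ) and m a box mass, the factors l
ρ^(γ+η), y (v/ρ)^(γ+1) and m/ρ on the right each converge as ρ ↓ 0. -/
theorem scaling_identity (γ η l m y : ℝ) {ρ v : ℝ} (hρ : 0 < ρ) (hv : 0 < v) :
    l * ρ⁻¹ * y * ((ρ ^ (1 - η / 2))⁻¹ * m) ^ 2 =
      l * ρ ^ (γ + η) * (y * (v / ρ) ^ (γ + 1)) / v ^ (γ + 1) * (m / ρ) ^ 2 := by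
  have h1 : ρ ^ (1 - η / 2) = ρ / ρ ^ (η / 2) := by rw [Real.rpow_sub hρ, Real.rpow_one]
  have h2 : ρ ^ (γ + η) = ρ ^ γ * (ρ ^ (η / 2)) ^ 2 := by
    rw [← Real.rpow_natCast (ρ ^ (η / 2)), ← Real.rpow_mul hρ.le, ← Real.rpow_add hρ]
    congr 1
    push_cast
    ring
  have h3 := Real.rpow_pos_of_pos hρ γ
  have h4 := Real.rpow_pos_of_pos hρ (η / 2)
  have h5 := Real.rpow_pos_of_pos hv (γ + 1)
  rw [Real.div_rpow hv.le hρ.le, h1, h2, Real.rpow_add_one hρ.ne' γ]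
  field_simp

/-- The constant 6 is 3 from the quadratic remainder bound times 2 from `hlρ`. -/
theorem norm_logCharIntegrand_le (h₁ : IsEdgeDensity γ₁ f₁) (h₂ : IsEdgeDensity γ₂ f₂) {K : ℝ}
    (hK : ∀ u, 0 < u → f₁ u ≤ K / u ^ (γ₁ + 1)) {l ρ : ℝ} (hl : 0 ≤ l) (hρ : 0 < ρ)
    (hlρ : l * ρ ^ (γ₁ + η) ≤ 2) (x : ℝ × ℝ) {v b : ℝ} (hv : 0 < v) (hb : 0 < b) :
    ‖logCharIntegrand η f₁ f₂ f l ρ (x, (v, b))‖ ≤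
      6 * K * f₂ b / v ^ (γ₁ + 1) * (boxMass f (x, (v, ρ * b)) / ρ) ^ 2 := by
  have hvρ : 0 < v / ρ := by positivity
  have a1 := h₁.nonneg _ hvρ
  have a2 := h₂.nonneg b hb
  have h3 : f₁ (v / ρ) * (v / ρ) ^ (γ₁ + 1) ≤ K := by
    rw [← le_div_iff₀ (by positivity)]
    exact hK _ hvρ
  rw [logCharIntegrand, norm_smul, Real.norm_of_nonneg (by positivity)]
  simp only []
  calc l * ρ⁻¹ * f₁ (v / ρ) * f₂ b *
        ‖expRemainder ((ρ ^ (1 - η / 2))⁻¹ * boxMass f (x, (v, ρ * b)))‖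
      ≤ l * ρ⁻¹ * f₁ (v / ρ) * f₂ b *
        (3 * ((ρ ^ (1 - η / 2))⁻¹ * boxMass f (x, (v, ρ * b))) ^ 2) := by
        gcongr
        exact norm_expRemainder_le _
    _ = 3 * f₂ b * (l * ρ⁻¹ * f₁ (v / ρ) *
          ((ρ ^ (1 - η / 2))⁻¹ * boxMass f (x, (v, ρ * b))) ^ 2) := by ring
    _ = 3 * f₂ b * (l * ρ ^ (γ₁ + η) * (f₁ (v / ρ) * (v / ρ) ^ (γ₁ + 1)) / v ^ (γ₁ + 1) *
          (boxMass f (x, (v, ρ * b)) / ρ) ^ 2) := by rw [scaling_identity γ₁ η l _ _ hρ hv]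
    _ ≤ 3 * f₂ b * (2 * K / v ^ (γ₁ + 1) * (boxMass f (x, (v, ρ * b)) / ρ) ^ 2) := by gcongr
    _ = _ := by ring

theorem tendsto_logCharIntegrand (hf : IsLineDensity f μ) (h₁ : IsEdgeDensity γ₁ f₁) (hη : 0 < η)
    {lam : ℝ → ℝ} (hlam : Tendsto (fun ρ => lam ρ * ρ ^ (γ₁ + η)) (𝓝[>] 0) (𝓝 1)) (x : ℝ × ℝ)
    {v b : ℝ} (hv : 0 < v) (hb : 0 < b) :
    Tendsto (fun ρ => logCharIntegrand η f₁ f₂ f (lam ρ) ρ (x, (v, b))) (𝓝[>] 0)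
      (𝓝 (((-1 / 2 : ℝ) * lineCovIntegrand γ₁ f₂ f f (x, (v, b)) : ℝ) : ℂ)) := by
  have hpos : ∀ᶠ ρ : ℝ in 𝓝[>] 0, 0 < ρ := self_mem_nhdsWithin
  have h0 : Tendsto (fun ρ : ℝ => ρ) (𝓝[>] 0) (𝓝 0) := tendsto_nhdsWithin_of_tendsto_nhds tendsto_id
  have hd : Tendsto (fun ρ : ℝ => ρ ^ (η / 2)) (𝓝[>] 0) (𝓝 0) := by
    have := h0.rpow_const (p := η / 2) (Or.inr (by positivity))
    rwa [Real.zero_rpow (by positivity)] at this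
  have hz : Tendsto (fun ρ => boxMass f (x, (v, ρ * b)) / ρ) (𝓝[>] 0)
      (𝓝 (b * lineMass f x v)) := by
    have hρb : Tendsto (fun ρ : ℝ => ρ * b) (𝓝[>] 0) (𝓝[>] 0) := by
      refine tendsto_nhdsWithin_iff.2 ⟨by simpa using h0.mul_const b, ?_⟩
      filter_upwards [hpos] with ρ hρ using mul_pos hρ hb
    refine (((hf.tendsto_boxMass x hv).comp hρb).const_mul b).congr fun ρ => ?_
    simp only [Function.comp_apply]
    field_simp
  -- The argument of the remainder is d · z with d = ρ^(η/2) → 0 and z = m/ρ convergent.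
  have hR := tendsto_expRemainder_div hd
    (by filter_upwards [hpos] with ρ hρ using (Real.rpow_pos_of_pos hρ _).ne') hz
  have hT : Tendsto (fun ρ => f₁ (v / ρ) * (v / ρ) ^ (γ₁ + 1)) (𝓝[>] 0) (𝓝 1) :=
    h₁.tendsto_mul_rpow.comp (tendsto_inv_nhdsGT_zero.const_mul_atTop hv)
  have hA := (Complex.continuous_ofReal.tendsto _).comp
    ((hlam.mul hT).mul_const (f₂ b / v ^ (γ₁ + 1)))
  have hfin := hA.mul hR
  have heq : ((1 * 1 * (f₂ b / v ^ (γ₁ + 1)) : ℝ) : ℂ) * (-((b * lineMass f x v : ℝ) : ℂ) ^ 2 / 2) =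
      (((-1 / 2 : ℝ) * lineCovIntegrand γ₁ f₂ f f (x, (v, b)) : ℝ) : ℂ) := by
    rw [lineCovIntegrand_eq]
    push_cast
    ring
  rw [heq] at hfin
  refine hfin.congr' ?_
  filter_upwards [hpos] with ρ hρ
  have h1 : (ρ ^ (1 - η / 2))⁻¹ * boxMass f (x, (v, ρ * b)) =
      ρ ^ (η / 2) * (boxMass f (x, (v, ρ * b)) / ρ) := by
    rw [Real.rpow_sub hρ, Real.rpow_one]
    field_simp
  have h2 := Real.rpow_pos_of_pos hρ (η / 2)
  have h3 : lam ρ * ρ⁻¹ * f₁ (v / ρ) * f₂ b = lam ρ * ρ ^ (γ₁ + η) *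
      (f₁ (v / ρ) * (v / ρ) ^ (γ₁ + 1)) * (f₂ b / v ^ (γ₁ + 1)) / (ρ ^ (η / 2)) ^ 2 := by
    -- Taking m = ρ makes the last factor 1 and isolates the coefficient.
    have := scaling_identity γ₁ η (lam ρ) ρ (f₁ (v / ρ)) hρ hv
    rw [Real.rpow_sub hρ, Real.rpow_one] at this
    field_simp at this ⊢
    linear_combination (f₂ b) * this
  rw [logCharIntegrand]
  simp only [Function.comp_apply]
  rw [h1, h3, Complex.real_smul]
  push_cast
  ring

/-- The logarithm of the characteristic function of the rescaled field converges to the one of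
the Gaussian limit. -/
theorem tendsto_integral_logCharIntegrand (hf : IsLineDensity f μ) (h₁ : IsEdgeDensity γ₁ f₁)
    (h₂ : IsEdgeDensity γ₂ f₂) (hγ₁ : γ₁ ∈ Ioo (1 : ℝ) 2) (hγ₂ : 2 < γ₂) (hη : 0 < η)
    (i₂ : IntegrableOn f₂ (Ioi 0)) {K : ℝ} (hK : ∀ u, 0 < u → f₁ u ≤ K / u ^ (γ₁ + 1))
    {lam : ℝ → ℝ} (hlam_pos : ∀ ρ, 0 < ρ → 0 < lam ρ)
    (hlam : Tendsto (fun ρ => lam ρ * ρ ^ (γ₁ + η)) (𝓝[>] 0) (𝓝 1)) :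
    Tendsto (fun ρ => ∫ p in boxParams, logCharIntegrand η f₁ f₂ f (lam ρ) ρ p) (𝓝[>] 0)
      (𝓝 (((-1 / 2 : ℝ) * ∫ p in boxParams, lineCovIntegrand γ₁ f₂ f f p : ℝ) : ℂ)) := by
  obtain ⟨C, hC, c, hc, hb⟩ := hf.decay
  have hK0 : 0 ≤ K := by
    have := (h₁.nonneg 1 one_pos).trans (hK 1 one_pos)
    simpa using this
  have hM := expTotal_nonneg c
  have hpos : ∀ᶠ ρ : ℝ in 𝓝[>] 0, 0 < ρ := self_mem_nhdsWithin
  have hle : ∀ᶠ ρ : ℝ in 𝓝[>] 0, ρ ≤ 1 :=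
    mem_of_superset (Ioc_mem_nhdsGT one_pos) fun ρ hρ => hρ.2
  have hbd : ∀ᶠ ρ in 𝓝[>] 0, ∀ x : ℝ × ℝ, ∀ v b, 0 < v → 0 < b →
      ‖logCharIntegrand η f₁ f₂ f (lam ρ) ρ (x, (v, b))‖ ≤ 6 * K * f₂ b / v ^ (γ₁ + 1) *
        (C ^ 2 / ρ ^ 2) * (expMass c x.1 v ^ 2 * expMass c x.2 (ρ * b) ^ 2) := by
    filter_upwards [hpos, hlam.eventually_le_const (by norm_num : (1 : ℝ) < 2)]
      with ρ hρ hlρ x v b hv hb0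
    refine (norm_logCharIntegrand_le h₁ h₂ hK (hlam_pos ρ hρ).le hρ hlρ x hv hb0).trans ?_
    have a2 := h₂.nonneg b hb0
    rw [mul_assoc (6 * K * f₂ b / v ^ (γ₁ + 1)), ← sq_abs, abs_div, abs_of_pos hρ]
    refine mul_le_mul_of_nonneg_left ?_ (by positivity)
    calc (|boxMass f (x, (v, ρ * b))| / ρ) ^ 2
        ≤ (C * (expMass c x.1 v * expMass c x.2 (ρ * b)) / ρ) ^ 2 := by
          gcongr
          exact abs_boxMass_le hc hb _
      _ = _ := by ring
  have hint (v b ρ : ℝ) (hv : 0 < v) (hb0 : 0 < b) (hρ : 0 < ρ) : Integrable fun x : ℝ × ℝ =>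
      6 * K * f₂ b / v ^ (γ₁ + 1) * (C ^ 2 / ρ ^ 2) *
        (expMass c x.1 v ^ 2 * expMass c x.2 (ρ * b) ^ 2) :=
    ((integrable_expMass_sq hc hv.le).mul_prod
      (integrable_expMass_sq hc (mul_pos hρ hb0).le)).const_mul _
  have hm (ρ : ℝ) := measurable_logCharIntegrand (η := η) hf.measurable h₁.measurable
    h₂.measurable (lam ρ) ρ
  have hk₁ := (integrableOn_min_mul_div_rpow (expTotal c) hM hγ₁).const_mul
    (6 * K * C ^ 2 * expTotal c ^ 2)
  have hk₂ := h₂.integrableOn_pow_mul i₂ (k := 2) (by exact_mod_cast hγ₂)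
  have hk : ∀ᶠ ρ in 𝓝[>] 0, ∀ v b, 0 < v → 0 < b →
      ∫ x, ‖logCharIntegrand η f₁ f₂ f (lam ρ) ρ (x, (v, b))‖ ≤
        6 * K * C ^ 2 * expTotal c ^ 2 * (min v (expTotal c) * v / v ^ (γ₁ + 1)) *
          (b ^ 2 * f₂ b) := by
    filter_upwards [hpos, hbd] with ρ hρ hbρ v b hv hb0
    have a2 := h₂.nonneg b hb0
    refine (integral_mono_of_nonneg (ae_of_all _ fun _ => norm_nonneg _) (hint v b ρ hv hb0 hρ)
      (ae_of_all _ fun x => hbρ x v b hv hb0)).trans ?_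
    rw [integral_const_mul, Measure.volume_eq_prod,
      integral_prod_mul (fun y => expMass c y v ^ 2) (fun y => expMass c y (ρ * b) ^ 2)]
    have e1 := integral_expMass_sq_le hc hv.le
    -- The thin direction contributes ρ², which cancels the ρ⁻² of the normalisation and leaves the
    -- second moment of f₂.
    have e2 : ∫ y, expMass c y (ρ * b) ^ 2 ≤ ρ * b * (ρ * b * expTotal c) :=
      (integral_expMass_sq_le hc (mul_pos hρ hb0).le).trans (by gcongr; exact min_le_left _ _)
    have e3 : 0 ≤ ∫ y, expMass c y (ρ * b) ^ 2 := integral_nonneg fun _ => sq_nonneg _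
    calc 6 * K * f₂ b / v ^ (γ₁ + 1) * (C ^ 2 / ρ ^ 2) *
          ((∫ y, expMass c y v ^ 2) * ∫ y, expMass c y (ρ * b) ^ 2)
        ≤ 6 * K * f₂ b / v ^ (γ₁ + 1) * (C ^ 2 / ρ ^ 2) *
          ((min v (expTotal c) * (v * expTotal c)) * (ρ * b * (ρ * b * expTotal c))) := by gcongr
      _ = _ := by field_simp
  have hlim := tendsto_setIntegral_boxParams (fun ρ => (hm ρ).stronglyMeasurable)
    (l := 𝓝[>] 0) (G₀ := fun p => (((-1 / 2 : ℝ) * lineCovIntegrand γ₁ f₂ f f p : ℝ) : ℂ))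
    ?_ ?_ ?_ hk₁ hk₂ hk fun x v b hv hb0 => tendsto_logCharIntegrand hf h₁ hη hlam x hv hb0
  · rwa [integral_complex_ofReal, integral_const_mul] at hlim
  · filter_upwards [hpos, hbd, hk] with ρ hρ hbρ hkρ
    exact integrableOn_boxParams (hm ρ).stronglyMeasurable (fun v b hv hb0 =>
      (hint v b ρ hv hb0 hρ).mono' ((hm ρ).comp (by fun_prop)).aestronglyMeasurable
        (ae_of_all _ fun x => hbρ x v b hv hb0)) hk₁ hk₂ hkρ
  · exact ((integrableOn_lineCovIntegrand_self hf h₂ hγ₁ hγ₂ i₂).const_mul _).ofReal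
  · intro v b hv hb0
    have a2 := h₂.nonneg b hb0
    -- This majorant grows like exp(cb), which is not integrable against the power tail of f₂. It
    -- therefore serves only for fixed edges; the edges are dominated by `hk`, after integration
    -- over positions.
    refine ⟨fun x => 6 * K * f₂ b / v ^ (γ₁ + 1) * C ^ 2 * (b * Real.exp (c * b / 2)) ^ 2 *
      (expMass c x.1 v ^ 2 * Real.exp (-c * |x.2|)), ?_, ?_⟩
    · exact ((integrable_expMass_sq hc hv.le).mul_prod (integrable_exp_neg_mul_abs hc)).const_mul _
    · filter_upwards [hpos, hle, hbd] with ρ hρ hρ1 hbρ x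
      refine (hbρ x v b hv hb0).trans ?_
      have e1 : expMass c x.2 (ρ * b) ^ 2 ≤
          ρ ^ 2 * ((b * Real.exp (c * b / 2)) ^ 2 * Real.exp (-c * |x.2|)) := by
        have e2 : expMass c x.2 (ρ * b) ≤
            ρ * b * (Real.exp (c * b / 2) * Real.exp (-c * |x.2|)) := by
          refine (expMass_le_mul_exp hc x.2 (mul_pos hρ hb0).le).trans ?_
          gcongr
          exact mul_le_of_le_one_left hb0.le hρ1
        have e3 : Real.exp (-c * |x.2|) ^ 2 ≤ Real.exp (-c * |x.2|) := by
          refine pow_le_of_le_one (Real.exp_pos _).le ?_ two_ne_zero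
          rw [Real.exp_le_one_iff]
          have := mul_nonneg hc.le (abs_nonneg x.2)
          linarith
        calc expMass c x.2 (ρ * b) ^ 2
            ≤ (ρ * b * (Real.exp (c * b / 2) * Real.exp (-c * |x.2|))) ^ 2 :=
              pow_le_pow_left₀ (expMass_nonneg _ _ _) e2 2
          _ = ρ ^ 2 * ((b * Real.exp (c * b / 2)) ^ 2 * Real.exp (-c * |x.2|) ^ 2) := by ring
          _ ≤ _ := by gcongr
      calc 6 * K * f₂ b / v ^ (γ₁ + 1) * (C ^ 2 / ρ ^ 2) *
            (expMass c x.1 v ^ 2 * expMass c x.2 (ρ * b) ^ 2)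
          ≤ 6 * K * f₂ b / v ^ (γ₁ + 1) * (C ^ 2 / ρ ^ 2) * (expMass c x.1 v ^ 2 *
            (ρ ^ 2 * ((b * Real.exp (c * b / 2)) ^ 2 * Real.exp (-c * |x.2|)))) := by gcongr
        _ = _ := by field_simp

end RandomBoxes

end

/-! ### The limit field, and linearity of the two fields. -/

noncomputable section

namespace RandomBoxes

variable {f g k : ℝ × ℝ → ℝ} {μ ν κ : SignedMeasure (ℝ × ℝ)} {γ γ₂ : ℝ} {f₂ : ℝ → ℝ}

/-- The density `k` need not be the combination of `f` and `g`; linearity comes from the box masses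
through the limit. -/
theorem IsLineDensity.lineMass_linear {a b : ℝ} (hf : IsLineDensity f μ) (hg : IsLineDensity g ν)
    (hk : IsLineDensity k (a • μ + b • ν)) (x : ℝ × ℝ) {v : ℝ} (hv : 0 < v) :
    lineMass k x v = a * lineMass f x v + b * lineMass g x v := by
  refine tendsto_nhds_unique (hk.tendsto_boxMass x hv) ((((hf.tendsto_boxMass x hv).const_mul a).add
    ((hg.tendsto_boxMass x hv).const_mul b)).congr fun ε => ?_)
  rw [← hf.measure_box, ← hg.measure_box, ← hk.measure_box]
  simp only [add_apply, smul_apply, smul_eq_mul]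
  ring

/-- The function on the space of box parameters whose inner products in `L²` give the covariance
function of the limit field. -/
def lineFeature (γ : ℝ) (f₂ : ℝ → ℝ) (f : ℝ × ℝ → ℝ) (p : (ℝ × ℝ) × (ℝ × ℝ)) : ℝ :=
  lineMass f p.1 p.2.1 * √(p.2.2 ^ 2 * f₂ p.2.2 / p.2.1 ^ (γ + 1))

theorem lineFeature_mul (h₂ : ∀ u, 0 < u → 0 ≤ f₂ u) {p : (ℝ × ℝ) × (ℝ × ℝ)}
    (hp : p ∈ boxParams) :
    lineFeature γ f₂ f p * lineFeature γ f₂ g p = lineCovIntegrand γ f₂ f g p := by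
  have h1 := h₂ _ hp.2.2
  have h2 : 0 < p.2.1 := hp.2.1
  rw [lineCovIntegrand_eq, lineFeature, lineFeature, mul_mul_mul_comm,
    Real.mul_self_sqrt (by positivity)]

theorem IsLineDensity.memLp_lineFeature (hf : IsLineDensity f μ) (h₂ : IsEdgeDensity γ₂ f₂)
    (hγ : γ ∈ Ioo (1 : ℝ) 2) (hγ₂ : 2 < γ₂) (i₂ : IntegrableOn f₂ (Ioi 0)) :
    MemLp (lineFeature γ f₂ f) 2 (volume.restrict boxParams) := by
  have hm : Measurable (lineFeature γ f₂ f) := by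
    have h1 := (measurable_lineMass hf.measurable).comp (measurable_fst.prodMk measurable_snd.fst :
      Measurable fun p : (ℝ × ℝ) × (ℝ × ℝ) => (p.1, p.2.1))
    have h3 := h₂.measurable
    exact h1.mul (by fun_prop)
  rw [memLp_two_iff_integrable_sq hm.aestronglyMeasurable]
  refine (integrableOn_lineCovIntegrand_self hf h₂ hγ hγ₂ i₂).congr ?_
  filter_upwards [ae_restrict_mem measurableSet_boxParams] with p hp
  rw [sq, lineFeature_mul h₂.nonneg hp]

/-- The Gaussian field with the covariance function of the limit. -/
theorem exists_isGaussianLineField (h₂ : IsEdgeDensity γ₂ f₂) (hγ : γ ∈ Ioo (1 : ℝ) 2)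
    (hγ₂ : 2 < γ₂) (i₂ : IntegrableOn f₂ (Ioi 0)) :
    ∃ (Ω : Type) (_ : MeasurableSpace Ω) (P : Measure Ω) (_ : IsProbabilityMeasure P)
      (Y : lineSpace → Ω → ℝ), IsGaussianLineField γ f₂ Y P := by
  -- The arbitrary choice of densities is harmless: line masses depend only, and linearly, on the
  -- measure.
  choose d hd using fun μ : lineSpace => μ.2
  let h (μ : lineSpace) : Lp ℝ 2 (volume.restrict boxParams) :=
    ((hd μ).memLp_lineFeature h₂ hγ hγ₂ i₂).toLp _
  have hcoe (μ : lineSpace) : h μ =ᵐ[volume.restrict boxParams] lineFeature γ f₂ (d μ) :=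
    MemLp.coeFn_toLp _
  obtain ⟨Ω, mΩ, P, hP, Y, hY, hlaw, hcov, hlin⟩ := exists_gaussianProcess h
  refine ⟨Ω, mΩ, P, hP, Y, hY, fun μ => ?_, fun a b μ ν => hlin a b μ ν _ ?_,
    fun μ ν f g hf hg => ?_⟩
  · have h1 := integral_map (μ := P) (f := fun x : ℝ => x) (hY.aemeasurable μ) (by fun_prop)
    rw [← h1, hlaw, integral_id_gaussianReal]
  · refine Lp.ext ?_
    filter_upwards [hcoe (a • μ + b • ν), hcoe μ, hcoe ν, Lp.coeFn_add (a • h μ) (b • h ν),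
      Lp.coeFn_smul a (h μ), Lp.coeFn_smul b (h ν), ae_restrict_mem measurableSet_boxParams]
      with p h1 h3 h4 h5 h6 h7 hp
    rw [h1, h5, Pi.add_apply, h6, h7, Pi.smul_apply, Pi.smul_apply, h3, h4, lineFeature,
      (hd μ).lineMass_linear (hd ν) (hd (a • μ + b • ν)) _ hp.2.1]
    simp only [lineFeature, smul_eq_mul]
    ring
  · rw [hcov, L2.inner_def]
    refine integral_congr_ae ?_
    filter_upwards [hcoe μ, hcoe ν, ae_restrict_mem measurableSet_boxParams] with p h1 h3 hp
    rw [h1, h3, real_inner_comm, real_inner_eq_re_inner, RCLike.inner_apply]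
    simp only [conj_trivial, RCLike.re_to_real]
    rw [lineFeature_mul h₂.nonneg hp, lineCovIntegrand_eq, lineCovIntegrand_eq,
      hf.lineMass_unique (hd μ) _ hp.2.1, hg.lineMass_unique (hd ν) _ hp.2.1]

theorem IsGaussianLineField.sum {Ω : Type*} [MeasurableSpace Ω] {P : Measure Ω}
    {Y : lineSpace → Ω → ℝ} (hY : IsGaussianLineField γ f₂ Y P) {ι : Type*} (s : Finset ι)
    (t : ι → ℝ) (μ : ι → lineSpace) :
    ∀ᵐ ω ∂P, Y (∑ i ∈ s, t i • μ i) ω = ∑ i ∈ s, t i * Y (μ i) ω := by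
  classical
  induction s using Finset.induction_on with
  -- Linearity with zero coefficients says that the field vanishes almost surely at 0.
  | empty => simpa using hY.linear 0 0 0 0
  | insert i s hi ih =>
    filter_upwards [ih, hY.linear (t i) 1 (μ i) (∑ i ∈ s, t i • μ i)] with ω h1 h2
    rw [Finset.sum_insert hi, Finset.sum_insert hi, ← h1]
    simpa using h2

theorem IsGaussianLineField.charFun_eq {Ω : Type*} [MeasurableSpace Ω] {P : Measure Ω}
    [IsProbabilityMeasure P] {Y : lineSpace → Ω → ℝ} (hY : IsGaussianLineField γ f₂ Y P)
    {μ : lineSpace} (hf : IsLineDensity f μ) :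
    charFun (P.map (Y μ)) 1 =
      Complex.exp (((-1 / 2 : ℝ) * ∫ p in boxParams, lineCovIntegrand γ f₂ f f p : ℝ) : ℂ) := by
  have hm := hY.gaussian.aemeasurable μ
  rw [(hY.gaussian.hasGaussianLaw_eval μ).map_eq_gaussianReal, charFun_gaussianReal, hY.centred,
    ← covariance_self hm, hY.covariance_eq μ μ f f hf hf]
  have h0 : 0 ≤ ∫ p in boxParams, lineCovIntegrand γ f₂ f f p := by
    rw [← hY.covariance_eq μ μ f f hf hf, covariance_self hm]
    exact variance_nonneg _ _
  rw [Real.coe_toNNReal _ h0]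
  push_cast
  ring_nf

section Poisson

variable {Ω : Type*} [MeasurableSpace Ω] {P : Measure Ω} [IsProbabilityMeasure P]
  {N : Ω → Measure ((ℝ × ℝ) × (ℝ × ℝ))} {n : Measure ((ℝ × ℝ) × (ℝ × ℝ))}

omit [MeasurableSpace Ω] in
theorem cumVolume_eq (hf : IsLineDensity f μ) :
    cumVolume N μ = fun ω => ∫ p, boxMass f p ∂(N ω) := by
  funext ω
  exact integral_congr_ae (ae_of_all _ hf.measure_box)

theorem integrable_cumVolume (hN : IsPoissonRandomMeasure N n P) (hf : IsLineDensity f μ)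
    (hi : Integrable (boxMass f) n) : Integrable (cumVolume N μ) P := by
  rw [cumVolume_eq hf]
  exact hN.integrable_integral (measurable_boxMass hf.measurable) hi

/-- Box masses are linear in the measure everywhere, but their integrals add only where all of them
converge, hence almost surely. -/
theorem centredVolume_sum (hN : IsPoissonRandomMeasure N n P) {ι : Type*} (s : Finset ι)
    (t : ι → ℝ) (μ : ι → lineSpace)
    (hi : ∀ (μ : lineSpace) f, IsLineDensity f μ → Integrable (boxMass f) n) :
    ∀ᵐ ω ∂P, centredVolume P N (∑ i ∈ s, t i • μ i : lineSpace) ω =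
      ∑ i ∈ s, t i * centredVolume P N (μ i) ω := by
  choose d hd using fun μ : lineSpace => μ.2
  have hcum : ∀ᵐ ω ∂P, cumVolume N (∑ i ∈ s, t i • μ i : lineSpace) ω =
      ∑ i ∈ s, t i * cumVolume N (μ i) ω := by
    have h1 : ∀ᵐ ω ∂P, ∀ i ∈ s, Integrable (boxMass (d (μ i))) (N ω) := by
      rw [Finset.eventually_all]
      exact fun i _ => hN.ae_integrable (measurable_boxMass (hd (μ i)).measurable) (hi _ _ (hd _))
    filter_upwards [h1] with ω hω
    have h2 (i : ι) : cumVolume N (μ i) ω = ∫ p, boxMass (d (μ i)) p ∂(N ω) :=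
      congrFun (cumVolume_eq (hd (μ i))) ω
    simp only [h2, ← integral_const_mul]
    rw [← integral_finsetSum _ fun i his => (hω i his).const_mul (t i)]
    refine integral_congr_ae (ae_of_all _ fun p => ?_)
    simp only [← (hd _).measure_box]
    simp
  have hmean : ∫ ω, cumVolume N (∑ i ∈ s, t i • μ i : lineSpace) ω ∂P =
      ∑ i ∈ s, t i * ∫ ω, cumVolume N (μ i) ω ∂P := by
    rw [integral_congr_ae hcum, integral_finsetSum _ fun i _ =>
      (integrable_cumVolume hN (hd (μ i)) (hi _ _ (hd _))).const_mul (t i)]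
    simp only [integral_const_mul]
  filter_upwards [hcum] with ω hω
  simp only [centredVolume]
  rw [hω, hmean, ← Finset.sum_sub_distrib]
  simp only [mul_sub]

theorem charFun_centredVolume_div (hN : IsPoissonRandomMeasure N n P) (hf : IsLineDensity f μ)
    (hi : Integrable (boxMass f) n) (s : ℝ) :
    charFun (P.map fun ω => centredVolume P N μ ω / s) 1 =
      Complex.exp (∫ p, expRemainder (s⁻¹ * boxMass f p) ∂n) := by
  have hm := measurable_boxMass hf.measurable
  have hmeas := (integrable_cumVolume hN hf hi).aemeasurable
  have h := hN.charFun_centred_integral hm hi s⁻¹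
  simp only [div_eq_inv_mul]
  rw [charFun_map_mul_comp (f := fun ω => centredVolume P N μ ω) (hmeas.sub_const _), mul_one]
  simp only [centredVolume, cumVolume_eq hf]
  exact h

end Poisson

end RandomBoxes

end

/-! ### The scaling limit. -/

open RandomBoxes in
theorem mainTheorem3
    (γ₁ γ₂ η : ℝ) (hγ₁ : γ₁ ∈ Set.Ioo (1 : ℝ) 2) (hγ₂ : 2 < γ₂) (hη : η ∈ Set.Ioo 0 γ₂)
    (f₁ f₂ : ℝ → ℝ)
    (hf₁ : RandomBoxes.IsEdgeDensity γ₁ f₁) (hf₂ : RandomBoxes.IsEdgeDensity γ₂ f₂)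
    (hF : IsProbabilityMeasure (RandomBoxes.edgeMeasure f₁ f₂))
    (hf₁_le : ∃ c > 0, ∀ u, 0 < u → f₁ u ≤ c / u ^ (γ₁ + 1))
    (lam : ℝ → ℝ) (hlam_pos : ∀ ρ, 0 < ρ → 0 < lam ρ)
    (hlam_top : Tendsto lam (𝓝[>] 0) atTop)
    (hlam : Tendsto (fun ρ => lam ρ * ρ ^ (γ₁ + η)) (𝓝[>] 0) (𝓝 1))
    (Ω : Set.Ioi (0 : ℝ) → Type*) [∀ ρ, MeasurableSpace (Ω ρ)]
    (P : ∀ ρ, Measure (Ω ρ)) [∀ ρ, IsProbabilityMeasure (P ρ)]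
    (N : ∀ ρ, Ω ρ → Measure ((ℝ × ℝ) × (ℝ × ℝ)))
    (hN : ∀ ρ, RandomBoxes.IsPoissonRandomMeasure (N ρ)
      (RandomBoxes.intensity (lam ρ) ρ (RandomBoxes.edgeMeasure f₁ f₂)) (P ρ)) :
    -- the random variables `J_ρ(μ)` are well defined and have a finite mean
    (∀ (ρ : Set.Ioi (0 : ℝ)) (μ : RandomBoxes.lineSpace),
      (∀ᵐ ω ∂(P ρ), Integrable
        (fun p => (μ : SignedMeasure (ℝ × ℝ)) (RandomBoxes.box p.1 p.2)) (N ρ ω)) ∧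
      Integrable (RandomBoxes.cumVolume (N ρ) (μ : SignedMeasure (ℝ × ℝ))) (P ρ)) ∧
    -- the covariance integrals converge absolutely
    (∀ (μ ν : RandomBoxes.lineSpace) (f g : ℝ × ℝ → ℝ),
      RandomBoxes.IsLineDensity f μ → RandomBoxes.IsLineDensity g ν →
      IntegrableOn (RandomBoxes.lineCovIntegrand γ₁ f₂ f g) RandomBoxes.boxParams) ∧
    -- the limit exists and the finite-dimensional distributions converge to those of the limit
    ∃ (Ω' : Type) (_ : MeasurableSpace Ω') (P' : Measure Ω') (_ : IsProbabilityMeasure P')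
      (Y : RandomBoxes.lineSpace → Ω' → ℝ),
      RandomBoxes.IsGaussianLineField γ₁ f₂ Y P' ∧
      ∀ (k : ℕ) (μ : Fin k → RandomBoxes.lineSpace),
        TendstoInDistribution
          (fun (ρ : Set.Ioi (0 : ℝ)) (ω : Ω ρ) (i : Fin k) =>
            RandomBoxes.centredVolume (P ρ) (N ρ) (μ i : SignedMeasure (ℝ × ℝ)) ω /
              (ρ : ℝ) ^ (1 - η / 2))
          (Filter.comap (fun ρ : Set.Ioi (0 : ℝ) => (ρ : ℝ)) (𝓝 0))
          (fun ω i => Y (μ i) ω) P P' := by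
  obtain ⟨K, -, hK⟩ := hf₁_le
  obtain ⟨i₁, i₂⟩ := hf₁.integrableOn hf₂ hF
  have hi (ρ : Set.Ioi (0 : ℝ)) (μ : lineSpace) (f : ℝ × ℝ → ℝ) (hf : IsLineDensity f μ) :
      Integrable (boxMass f) (intensity (lam ρ) ρ (edgeMeasure f₁ f₂)) :=
    integrable_boxMass_intensity hf hf₁ hf₂ hγ₁.1 (by linarith) hF ρ.2 _
  refine ⟨fun ρ μ => ?_, fun μ ν f g hf hg =>
    integrableOn_lineCovIntegrand hf hg hf₂ hγ₁ hγ₂ i₂, ?_⟩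
  · obtain ⟨f, hf⟩ := μ.2
    refine ⟨?_, integrable_cumVolume (hN ρ) hf (hi ρ μ f hf)⟩
    simp only [hf.measure_box]
    exact (hN ρ).ae_integrable (measurable_boxMass hf.measurable) (hi ρ μ f hf)
  obtain ⟨Ω', mΩ', P', hP', Y, hY⟩ := exists_isGaussianLineField hf₂ hγ₁ hγ₂ i₂
  refine ⟨Ω', mΩ', P', hP', Y, hY, fun k μ => ?_⟩
  have hcentred (ρ : Set.Ioi (0 : ℝ)) (μ : lineSpace) :
      AEMeasurable (centredVolume (P ρ) (N ρ) μ) (P ρ) := by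
    obtain ⟨f, hf⟩ := μ.2
    exact (integrable_cumVolume (hN ρ) hf (hi ρ μ f hf)).aemeasurable.sub_const _
  refine tendstoInDistribution_of_tendsto_charFun
    (fun ρ => aemeasurable_pi_lambda _ fun i => (hcentred ρ (μ i)).div_const _)
    (aemeasurable_pi_lambda _ fun i => hY.gaussian.aemeasurable (μ i)) fun t => ?_
  -- By linearity of both fields, the combination with coefficients `t` is the field at one measure,
  -- so one density suffices.
  obtain ⟨f, hf⟩ := (∑ i, t i • μ i : lineSpace).2
  have hlimit : charFun (P'.map fun ω => ∑ i, t i * Y (μ i) ω) 1 =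
      Complex.exp (((-1 / 2 : ℝ) * ∫ p in boxParams, lineCovIntegrand γ₁ f₂ f f p : ℝ) : ℂ) := by
    rw [← hY.charFun_eq hf, Measure.map_congr (hY.sum Finset.univ t μ)]
  have hpre (ρ : Set.Ioi (0 : ℝ)) : charFun ((P ρ).map fun ω =>
      ∑ i, t i * (centredVolume (P ρ) (N ρ) (μ i) ω / (ρ : ℝ) ^ (1 - η / 2))) 1 =
      Complex.exp (∫ p in boxParams, logCharIntegrand η f₁ f₂ f (lam ρ) ρ p) := by
    rw [← integral_intensity_expRemainder hf hf₁ hf₂ (hlam_pos ρ ρ.2).le ρ.2,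
      ← charFun_centredVolume_div (hN ρ) hf (hi ρ _ f hf)]
    refine congrArg (fun m => charFun m 1) (Measure.map_congr ?_)
    filter_upwards [centredVolume_sum (hN ρ) Finset.univ t μ (hi ρ)] with ω hω
    rw [hω, Finset.sum_div]
    exact Finset.sum_congr rfl fun i _ => (mul_div_assoc _ _ _).symm
  have hρ : Tendsto (fun ρ : Set.Ioi (0 : ℝ) => (ρ : ℝ))
      (Filter.comap (fun ρ : Set.Ioi (0 : ℝ) => (ρ : ℝ)) (𝓝 0)) (𝓝[>] 0) :=
    tendsto_nhdsWithin_iff.2 ⟨tendsto_comap, Eventually.of_forall fun ρ => ρ.2⟩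
  have hlog := (tendsto_integral_logCharIntegrand hf hf₁ hf₂ hγ₁ hγ₂ hη.1 i₂ hK hlam_pos hlam).comp hρ
  rw [hlimit]
  exact ((Complex.continuous_exp.tendsto _).comp hlog).congr fun ρ => (hpre ρ).symm
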